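/- \textbf{Setting.} Let $d_0<d_1<d_2<\cdots$ be dimensions, let $V_N\subseteq\mathbb R^{d_N}$ be open sets such that the projection of $V_{N+1}$ onto the first $d_N$ coordinates is $V_N$, and let $\mathcal U_N\in C^2(V_N)$ be potentials. Let $\beta,m>0$ and assume $0<Z_\beta:=\sum_{N\ge0}\int_{V_N}e^{-\beta\,\mathcal U_N(q)}\,dq<\infty$. The phase space is $S=\bigcup_{N\ge 0}V_N\times\mathbb R^{d_N}\times[N,N+1)\times\mathbb R$, with points $(q,p,n,p_n)$; write $\varphi=(q,n)$, $\psi=(p,p_n)$, with a subscript $N$ if $n\in[N,N+1)$. Let $K(p)=\|p\|^2/(2m)$ and, with $m_n=1$, $K_n(p_n)=|p_n|$. On the $N$-th component the extended target $\bar\pi$ has the density $$\bar\pi(q,p,n,p_n)=\frac{e^{-\beta\,\mathcal U_N(q)}}{Z_\beta}\cdot\frac{e^{-\beta K(p)}}{(2m\pi/\beta)^{d_N/2}}\cdot\frac{e^{-\beta |p_n|}}{2/\beta}$$ with respect to Lebesgue measure. Put $\mathcal H_N(q,p)=\mathcal U_N(q)+K(p)+\frac{d_N}{2\beta}\log\frac{2m\pi}{\beta}$.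 Assume that for each $N$ the Hamiltonian system $\dot q=p/m$, $\dot p=-\nabla\mathcal U_N(q)$ has, from each point of $V_N\times\mathbb R^{d_N}$, a solution in $V_N\times\mathbb R^{d_N}$ for all times. For each $N$ and $(q,p)\in V_N\times\mathbb R^{d_N}$ let $\pi_{N,N+1}(\cdot,\cdot\,;q,p)$ be a probability density on $\{(q_{\rm new},p_{\rm new})\in(\mathbb R^{d_{N+1}-d_N})^2:[q,q_{\rm new}]\in V_{N+1}\}$, jointly measurable in all the variables. \textbf{Dynamics.} While $n$ is in the interior of $[N,N+1]$, $(q,p)$ follows the Hamiltonian system above, $\dot n=\operatorname{sign}(p_n)$ (with $\operatorname{sign}(0)=1$), and $p_n$ is constant. When $n$ hits $N+1$ from the left, $(q_{\rm new},p_{\rm new})$ is sampled from $\pi_{N,N+1}(\cdot,\cdot\,;q,p)$, the point $(\tilde q,\tilde p)=([q,q_{\rm new}],[p,p_{\rm new}])$ is proposed, and $$\delta\mathcal H=\mathcal H_{N+1}(\tilde q,\tilde p)-\mathcal H_N(q,p)+\tfrac1\beta\log\pi_{N,N+1}(q_{\rm new},p_{\rm new};q,p).$$ When $n$ hits $N$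 from the right and $N\ge1$, the point $(\tilde q,\tilde p)$ that consists of the first $d_{N-1}$ coordinates of $q$ and of $p$ is proposed, and, with $(q_{\rm last},p_{\rm last})$ the removed coordinates, $$\delta\mathcal H=\mathcal H_{N-1}(\tilde q,\tilde p)-\mathcal H_N(q,p)-\tfrac1\beta\log\pi_{N-1,N}(q_{\rm last},p_{\rm last};\tilde q,\tilde p)$$ (where $\log 0=-\infty$); if $N=0$, then $\delta\mathcal H=+\infty$. If $K_n(p_n)\ge\delta\mathcal H$, the proposal is accepted and $p_n$ becomes $p_n-\operatorname{sign}(p_n)\,\delta\mathcal H$; otherwise it is rejected, $(q,p)$ is kept, and $p_n$ becomes $-p_n$. The motion then continues. Let $\Gamma_T$ be the transition kernel of this dynamics for the time length $T$. \textbf{Lemma.} Assume $m_n=1$, $0\le T<1$, and that the insertion densities are even in the momenta: $\pi_{N,N+1}(q_{\rm new},-p_{\rm new};q,-p)=\pi_{N,N+1}(q_{\rm new},p_{\rm new};q,p)$. Then $\Gamma_T$ is a Markov transition kernel from $S$, and it satisfies the skew detailed balance $$\bar\pi(\varphi_N,\psi_N)\,\Gamma_T(\varphi_N,\psi_N\to\varphi_M,\psi_M)=\bar\pi(\varphi_M,-\psi_M)\,\Gamma_T(\varphi_M,-\psi_M\to\varphi_N,-\psi_N)$$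 as an identity of measures: with $R(\varphi,\psi)=(\varphi,-\psi)$, for all measurable sets $A,B$ of states, $$\int_A\Gamma_T(x,B)\,\bar\pi(dx)=\int_{R^{-1}B}\Gamma_T(x,R^{-1}A)\,\bar\pi(dx).$$ -/

import Mathlib

open MeasureTheory

noncomputable section

namespace DHMC

/-- `ℝ ^ k` with its Euclidean norm and Lebesgue measure. -/
abbrev RVec (k : ℕ) : Type := EuclideanSpace ℝ (Fin k)

/-- The first `a` coordinates of `v`. -/
def head {a b : ℕ} (h : a ≤ b) (v : RVec b) : RVec a :=
  WithLp.toLp 2 fun i => v (Fin.castLE h i)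

/-- The last `b - a` coordinates of `v`. -/
def tail {a b : ℕ} (v : RVec b) : RVec (b - a) :=
  WithLp.toLp 2 fun i => v ⟨a + i, by omega⟩

/-- The concatenation `[v, w]`. -/
def append {a b : ℕ} (v : RVec a) (w : RVec (b - a)) : RVec b :=
  WithLp.toLp 2 fun i => if h : (i : ℕ) < a then v ⟨i, h⟩ else w ⟨i - a, by omega⟩

/-- The data of a trans-dimensional sampling problem, with the standing assumptions on them. -/
structure Model where
  /-- the dimensions `d_N` -/
  d : ℕ → ℕ
  d_strictMono : StrictMono d
  /-- the configuration domains `V_{d_N} ⊆ ℝ ^ d_N` -/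
  V : ∀ N, Set (RVec (d N))
  isOpen_V : ∀ N, IsOpen (V N)
  head_image_V : ∀ N, head (d_strictMono N.lt_succ_self).le '' V (N + 1) = V N
  /-- the potentials `U_N` on `V_{d_N}` (values off the domain play no role) -/
  U : ∀ N, RVec (d N) → ℝ
  contDiffOn_U : ∀ N, ContDiffOn ℝ 2 (U N) (V N)
  /-- inverse temperature -/
  β : ℝ
  β_pos : 0 < β
  /-- mass attached to the momentum `p` -/
  m : ℝ
  m_pos : 0 < m
  /-- mass attached to the momentum `p_n` of the indicator -/
  mn : ℝ
  mn_pos : 0 < mn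
  Z_pos : 0 < ∑' N, ∫⁻ q in V N, ENNReal.ofReal (Real.exp (-β * U N q))
  Z_lt_top : ∑' N, ∫⁻ q in V N, ENNReal.ofReal (Real.exp (-β * U N q)) < ⊤
  /-- the insertion densities: `ins N (q_new, p_new) (q, p) = π_{N,N+1}(q_new, p_new; q, p)` -/
  ins : ∀ N, RVec (d (N + 1) - d N) × RVec (d (N + 1) - d N) → RVec (d N) × RVec (d N) → ℝ
  ins_nonneg : ∀ N w x, 0 ≤ ins N w x
  measurable_ins : ∀ N, Measurable (Function.uncurry (ins N))
  lintegral_ins : ∀ N x, x.1 ∈ V N → ∫⁻ w, ENNReal.ofReal (ins N w x) = 1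
  ins_support : ∀ N w x, x.1 ∈ V N → append x.1 w.1 ∉ V (N + 1) → ins N w x = 0

namespace Model

variable (M : Model)

/-- The pairs `(q, p)` in dimension `d_N`. -/
abbrev QP (N : ℕ) : Type := RVec (M.d N) × RVec (M.d N)

/-- Points `⟨N, ((q, p), (n, p_n))⟩`. -/
abbrev State : Type := Σ N : ℕ, M.QP N × (ℝ × ℝ)

/-- The states with `q ∈ V_{d_N}` and `n ∈ [N, N + 1)`. -/
def phaseSpace : Set M.State :=
  {s | s.2.1.1 ∈ M.V s.1 ∧ s.2.2.1 ∈ Set.Ico (s.1 : ℝ) (s.1 + 1)}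

/-- Reversal of all momenta, `(φ, ψ) ↦ (φ, -ψ)`. -/
def flip (s : M.State) : M.State :=
  ⟨s.1, ((s.2.1.1, -s.2.1.2), (s.2.2.1, -s.2.2.2))⟩

/-! ### The extended target distribution -/

/-- `K(p) = ‖p‖² / (2m)`. -/
def kin {k : ℕ} (p : RVec k) : ℝ := ‖p‖ ^ 2 / (2 * M.m)

/-- `K_n(p_n) = |p_n| / m_n`. -/
def kinN (pn : ℝ) : ℝ := |pn| / M.mn

/-- The partition function `Z_β`. -/
def Zβ : ℝ := (∑' N, ∫⁻ q in M.V N, ENNReal.ofReal (Real.exp (-M.β * M.U N q))).toReal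

/-- The Gaussian normalization `(2mπ/β)^{d_N/2}`. -/
def Zp (N : ℕ) : ℝ := (2 * M.m * Real.pi / M.β) ^ ((M.d N : ℝ) / 2)

/-- The Laplace normalization `∫ exp (-β K_n) = 2 m_n / β`. -/
def Zn : ℝ := 2 * M.mn / M.β

/-- The density of the extended target on the component with index `N`. -/
def density (N : ℕ) (z : M.QP N × (ℝ × ℝ)) : ℝ :=
  (M.Zβ⁻¹ * Real.exp (-M.β * M.U N z.1.1)) * ((M.Zp N)⁻¹ * Real.exp (-M.β * M.kin z.1.2)) *
    (M.Zn⁻¹ * Real.exp (-M.β * M.kinN z.2.2))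

/-- The extended target distribution `π̄(dq dp dn dp_n)`, carried by
`⋃_N V_{d_N} × ℝ ^ d_N × [N, N + 1) × ℝ`. -/
def target : Measure M.State :=
  Measure.sum fun N : ℕ =>
    ((volume.restrict
        {z : M.QP N × (ℝ × ℝ) | z.1.1 ∈ M.V N ∧ z.2.1 ∈ Set.Ico (N : ℝ) (N + 1)}).withDensity
      fun z => ENNReal.ofReal (M.density N z)).map (Sigma.mk N)

/-- The Hamiltonian on the component with index `N`, without the term `K_n(p_n)` and the
additive constant, which are common to all the components. -/
def ham (N : ℕ) (x : M.QP N) : ℝ :=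
  M.U N x.1 + M.kin x.2 + M.d N / (2 * M.β) * Real.log (2 * M.m * Real.pi / M.β)

/-! ### The motion between two crossings -/

/-- `γ` solves `q' = p / m`, `p' = -∇U_N(q)` for all times, with `q` staying in `V_{d_N}`. -/
def IsTrajectory (N : ℕ) (γ : ℝ → M.QP N) : Prop :=
  ∀ t, (γ t).1 ∈ M.V N ∧
    HasDerivAt γ ((1 / M.m) • (γ t).2, -gradient (M.U N) (γ t).1) t

/-- The Hamiltonian equations are globally solvable on every `V_{d_N} × ℝ ^ d_N`. -/
def Complete : Prop :=
  ∀ N (x : M.QP N), x.1 ∈ M.V N → ∃ γ, M.IsTrajectory N γ ∧ γ 0 = x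

open Classical in
/-- The Hamiltonian flow `F_t` on `V_{d_N} × ℝ ^ d_N` (the identity where there is no solution). -/
def flow (N : ℕ) (t : ℝ) (x : M.QP N) : M.QP N :=
  if h : ∃ γ, M.IsTrajectory N γ ∧ γ 0 = x then h.choose t else x

/-- The sign, with `sgn 0 = 1`. -/
def sgn (r : ℝ) : ℝ := if 0 ≤ r then 1 else -1

/-- The motion for time `t` without crossings: `(q, p)` follows the Hamiltonian flow,
`n' = sgn p_n / m_n`, and `p_n` is constant. -/
def freeMove (t : ℝ) (s : M.State) : M.State :=
  ⟨s.1, (M.flow s.1 t s.2.1, (s.2.2.1 + t * (sgn s.2.2.2 / M.mn), s.2.2.2))⟩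

/-- The time at which `n` reaches an end point of `[N, N + 1]`. -/
def hitTime (s : M.State) : ℝ :=
  if 0 ≤ s.2.2.2 then M.mn * (s.1 + 1 - s.2.2.1) else M.mn * (s.2.2.1 - s.1)

/-! ### The crossings -/

/-- The state `([q, q_new], [p, p_new])`. -/
def extend (N : ℕ) (x : M.QP N)
    (w : RVec (M.d (N + 1) - M.d N) × RVec (M.d (N + 1) - M.d N)) : M.QP (N + 1) :=
  (append x.1 w.1, append x.2 w.2)

/-- Keep the first `d_N` coordinates of `q` and `p`. -/
def truncate (N : ℕ) (x : M.QP (N + 1)) : M.QP N :=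
  (head (M.d_strictMono N.lt_succ_self).le x.1, head (M.d_strictMono N.lt_succ_self).le x.2)

/-- The coordinates of `q` and `p` that `truncate` removes. -/
def removed (N : ℕ) (x : M.QP (N + 1)) :
    RVec (M.d (N + 1) - M.d N) × RVec (M.d (N + 1) - M.d N) :=
  (tail x.1, tail x.2)

/-- The free energy barrier `δH⁺ = ΔH⁺ + β⁻¹ log π_{N,N+1}` of an insertion. -/
def barrierUp (N : ℕ) (x : M.QP N)
    (w : RVec (M.d (N + 1) - M.d N) × RVec (M.d (N + 1) - M.d N)) : ℝ :=
  M.ham (N + 1) (M.extend N x w) - M.ham N x + 1 / M.β * Real.log (M.ins N w x)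

/-- The free energy barrier `δH⁻ = ΔH⁻ - β⁻¹ log π_{N,N+1}` of a deletion, where
`π_{N,N+1} > 0`. -/
def barrierDown (N : ℕ) (x : M.QP (N + 1)) : ℝ :=
  M.ham N (M.truncate N x) - M.ham (N + 1) x
    - 1 / M.β * Real.log (M.ins N (M.removed N x) (M.truncate N x))

open Classical in
/-- The state just after an attempt to insert the coordinates `w`. -/
def afterInsertion (N : ℕ) (x : M.QP N) (n pn : ℝ)
    (w : RVec (M.d (N + 1) - M.d N) × RVec (M.d (N + 1) - M.d N)) : M.State :=
  if M.barrierUp N x w ≤ M.kinN pn then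
    ⟨N + 1, (M.extend N x w, (n, pn - sgn pn * (M.mn * M.barrierUp N x w)))⟩
  else ⟨N, (x, (n, -pn))⟩

open Classical in
/-- The state just after an attempt to delete coordinates. The barrier is `+∞` at index `0`, and
also where the insertion density vanishes (because `log 0 = -∞`): there the move is rejected. -/
def afterDeletion : (N : ℕ) → M.QP N → ℝ → ℝ → M.State
  | 0, x, n, pn => ⟨0, (x, (n, -pn))⟩
  | N + 1, x, n, pn =>
    if 0 < M.ins N (M.removed N x) (M.truncate N x) ∧ M.barrierDown N x ≤ M.kinN pn then
      ⟨N, (M.truncate N x, (n, pn - sgn pn * (M.mn * M.barrierDown N x)))⟩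
    else ⟨N + 1, (x, (n, -pn))⟩

open Classical in
/-- The law of the state just after `n` has hit an integer. -/
def jump (s : M.State) : Measure M.State :=
  if 0 ≤ s.2.2.2 then
    (volume.withDensity fun w => ENNReal.ofReal (M.ins s.1 w s.2.1)).map
      (M.afterInsertion s.1 s.2.1 s.2.2.1 s.2.2.2)
  else Measure.dirac (M.afterDeletion s.1 s.2.1 s.2.2.1 s.2.2.2)

/-! ### The transition kernel -/

open Classical in
/-- The law at time `T` of the dynamics started at `s`, with at most `k` integer hits processed. -/
def kernelAux : ℕ → ℝ → M.State → Measure M.State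
  | 0, T, s => Measure.dirac (M.freeMove T s)
  | k + 1, T, s =>
    if M.hitTime s ≤ T then
      (M.jump (M.freeMove (M.hitTime s) s)).bind (kernelAux k (T - M.hitTime s))
    else Measure.dirac (M.freeMove T s)

/-- The transition kernel `Γ_T`. Successive hits are separated by the time `m_n`, so that there
are at most `⌊T / m_n⌋ + 1` of them up to time `T`. -/
def kernel (T : ℝ) : M.State → Measure M.State := M.kernelAux (⌊T / M.mn⌋₊ + 1) T

end Model

end DHMC

end

/-! Up to a constant, the target on component `N` is `e^{-β|p_n|} dp_n dn` times `e^{-β H_N(q,p)} dq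
dp`: the constant in `ham` absorbs the Gaussian normalization, which depends on the dimension. For
`T < 1` and unit speed at most one integer is hit, so a transition either has no crossing or is free
motion for a time `h`, one crossing, and free motion for the time `T - h`. Each piece is reversible
up to a change of sign of the momenta.

Free motion preserves the Gibbs measures by conservation of energy and Liouville's theorem, and
conjugation with momentum reversal inverts it. Without a crossing, translation of `n` by `T` then
exchanges a path with its reversal (`Regular.lintegral_freeMassAt`). With a crossing, the starting
value of `n` is replaced by the exit time `h`, whose law is Lebesgue measure on `[0, T]`, and `h ↦ T
- h` exchanges the two free pieces.

What remains is skew balance at the crossing itself (`Regular.crossing_skew_balance`). A rejection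
only changes the sign of `p_n`, hence is its own skew reversal. An accepted insertion replaces `v =
p_n` by `u = v - δ`, where `δ` is its barrier; the matching deletion has barrier `-δ` and undoes it.
Since `δ = H_{N+1} - H_N + β⁻¹ log π`, the weights satisfy `e^{-βH_{N+1}} e^{-βu} = e^{-βH_N} π
e^{-βv}`, and `v ↦ u` is a translation (`Regular.setLIntegral_deletion_eq`).

The flow is available only through existence of solutions on an open domain. Uniqueness,
measurability and invariance of volume are all drawn from one fact: the iterates of the symplectic
Euler scheme, which are measurable and preserve volume, converge pointwise to every global
trajectory. Balance is proved for models extended by zero off the domains and transferred at the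
end, as the target does not see those points. -/

noncomputable section

namespace DHMC

open Filter Set ProbabilityTheory
open scoped ENNReal Topology

/-! ### One-step methods and the symplectic Euler scheme -/

/-- Convergence of a consistent one-step method whose stability is only known near the solution. -/
theorem tendsto_iterate_of_consistent {E : Type*} [NormedAddCommGroup E] (S : ℝ → E → E)
    (γ : ℝ → E) (t L r : ℝ) (hL : 0 ≤ L) (hr : 0 < r)
    (hS : ∀ ε > 0, ∃ δ > 0, ∀ h, |h| ≤ δ → ∀ s ∈ uIcc 0 t, s + h ∈ uIcc 0 t →
      ∀ y, ‖y - γ s‖ ≤ r → ‖S h y - γ (s + h)‖ ≤ (1 + |h| * L) * ‖y - γ s‖ + |h| * ε) :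
    Tendsto (fun n : ℕ => (S (t / n))^[n] (γ 0)) atTop (𝓝 (γ t)) := by
  rw [Metric.tendsto_atTop]
  intro e he
  -- The global error will be at most `|t| ε e^{|t|L}`. Making this less than `min e r` gives the
  -- required accuracy and also keeps the iterates in the tube of radius `r` where stability is
  -- known. The summand `1` keeps `C` positive for `t = 0`.
  set C := |t| * Real.exp (|t| * L) + 1 with hC
  have hC0 : 0 < C := by positivity
  have hmin : 0 < min e r := lt_min he hr
  obtain ⟨δ, hδ, hδS⟩ := hS (min e r / (2 * C)) (by positivity)
  set ε := min e r / (2 * C) with hε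
  have hε0 : 0 < ε := by positivity
  have hbound : |t| * ε * Real.exp (|t| * L) < min e r := by
    have h1 : |t| * Real.exp (|t| * L) * ε ≤ C * ε := by
      gcongr; linarith
    have h2 : C * ε = min e r / 2 := by rw [hε]; field_simp
    nlinarith
  obtain ⟨N, hN⟩ := exists_nat_gt (|t| / δ)
  refine ⟨max N 1, fun n hn => ?_⟩
  have hn1 : 1 ≤ n := le_trans (le_max_right _ _) hn
  have hn0 : (0 : ℝ) < n := by exact_mod_cast hn1
  have hNn : |t| / δ < n := hN.trans_le (by exact_mod_cast le_trans (le_max_left _ _) hn)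
  set h := t / n with hh
  have hah : |h| = |t| / n := by rw [hh, abs_div, abs_of_pos hn0]
  have hhδ : |h| ≤ δ := by
    rw [hah, div_le_iff₀ hn0]
    rw [div_lt_iff₀ hδ] at hNn
    linarith
  have hmem : ∀ k : ℕ, k ≤ n → (k : ℝ) * h ∈ uIcc 0 t := by
    intro k hk
    have : (k : ℝ) / n ∈ Icc (0 : ℝ) 1 :=
      ⟨by positivity, (div_le_one hn0).2 (by exact_mod_cast hk)⟩
    rw [hh, show (k : ℝ) * (t / n) = (k / n) * t by ring]
    rcases le_total 0 t with ht | ht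
    · rw [uIcc_of_le ht]; exact ⟨by have := this.1; positivity, by nlinarith [this.2]⟩
    · rw [uIcc_of_ge ht]; exact ⟨by nlinarith [this.2], by nlinarith [this.1]⟩
  have hkt : ∀ k : ℕ, k ≤ n → (k : ℝ) * |h| ≤ |t| := by
    intro k hk
    rw [hah, mul_div_assoc', div_le_iff₀ hn0]
    have : (k : ℝ) ≤ n := by exact_mod_cast hk
    nlinarith [abs_nonneg t]
  -- Discrete Grönwall estimate; the bound at step `k` is what permits the use of the local
  -- stability for step `k + 1`.
  have key : ∀ k : ℕ, k ≤ n →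
      ‖(S h)^[k] (γ 0) - γ (k * h)‖ ≤ k * |h| * ε * Real.exp (k * |h| * L) := by
    intro k
    induction k with
    | zero => intro _; simp
    | succ k ih =>
      intro hk
      have hk' : k ≤ n := by omega
      have ihk := ih hk'
      have hle : ‖(S h)^[k] (γ 0) - γ (k * h)‖ ≤ r := by
        refine ihk.trans (le_trans ?_ (hbound.le.trans (min_le_right _ _)))
        gcongr
        · exact hkt k hk'
        · exact hkt k hk'
      have hadd : (k : ℝ) * h + h = ((k + 1 : ℕ) : ℝ) * h := by push_cast; ring
      have := hδS h hhδ _ (hmem k hk') (by rw [hadd]; exact hmem _ hk) _ hle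
      rw [hadd, ← Function.iterate_succ_apply' (S h)] at this
      refine this.trans ?_
      have h1 : 1 + |h| * L ≤ Real.exp (|h| * L) := by
        have := Real.add_one_le_exp (|h| * L); linarith
      have h2 : (1 : ℝ) ≤ Real.exp ((k + 1 : ℕ) * |h| * L) := Real.one_le_exp (by positivity)
      have h3 : Real.exp ((k + 1 : ℕ) * |h| * L)
          = Real.exp (|h| * L) * Real.exp (k * |h| * L) := by
        rw [← Real.exp_add]; congr 1; push_cast; ring
      calc (1 + |h| * L) * ‖(S h)^[k] (γ 0) - γ (k * h)‖ + |h| * ε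
          ≤ Real.exp (|h| * L) * (k * |h| * ε * Real.exp (k * |h| * L)) + |h| * ε * 1 := by
            rw [mul_one]; gcongr
        _ ≤ Real.exp (|h| * L) * (k * |h| * ε * Real.exp (k * |h| * L))
            + |h| * ε * Real.exp ((k + 1 : ℕ) * |h| * L) := by gcongr
        _ = (k + 1 : ℕ) * |h| * ε * Real.exp ((k + 1 : ℕ) * |h| * L) := by
            rw [h3]; push_cast; ring
  have hfin := key n le_rfl
  have hnh : (n : ℝ) * h = t := by rw [hh]; field_simp
  have hnh' : (n : ℝ) * |h| = |t| := by rw [hah]; field_simp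
  rw [hnh, hnh'] at hfin
  rw [dist_eq_norm]
  exact hfin.trans_lt (hbound.trans_le (min_le_left _ _))

/-- A first-order Taylor estimate, uniform on a compact interval. -/
theorem exists_taylor_bound {E : Type*} [NormedAddCommGroup E] [NormedSpace ℝ E]
    {γ γ' : ℝ → E} (hγ : ∀ s, HasDerivAt γ (γ' s) s) (hγ' : Continuous γ') (t ε : ℝ) (hε : 0 < ε) :
    ∃ δ > 0, ∀ h, |h| ≤ δ → ∀ s ∈ uIcc 0 t, s + h ∈ uIcc 0 t →
      ‖γ (s + h) - γ s - h • γ' s‖ ≤ |h| * ε := by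
  have huc := (isCompact_uIcc (a := (0 : ℝ)) (b := t)).uniformContinuousOn_of_continuous
    hγ'.continuousOn
  rw [Metric.uniformContinuousOn_iff_le] at huc
  obtain ⟨δ, hδ, H⟩ := huc ε hε
  refine ⟨δ, hδ, fun h hh s hs hsh => ?_⟩
  have hsub : uIcc s (s + h) ⊆ uIcc 0 t := uIcc_subset_uIcc hs hsh
  -- Mean value inequality for `u ↦ γ u - u • γ' s`, whose derivative is small by uniform continuity
  -- of `γ'`.
  have := (convex_uIcc s (s + h)).norm_image_sub_le_of_norm_hasDerivWithin_le
    (f := fun u => γ u - u • γ' s) (f' := fun u => γ' u - γ' s) (C := ε)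
    (fun u _ => by
      have := (hγ u).sub ((hasDerivAt_id u).smul_const (γ' s))
      rw [one_smul] at this
      exact this.hasDerivWithinAt)
    (fun u hu => by
      rw [← dist_eq_norm]
      refine H u (hsub hu) s hs ?_
      rw [Real.dist_eq]
      have : |u - s| ≤ |s + h - s| := abs_sub_left_of_mem_uIcc hu
      simpa using this.trans (by simpa using hh))
    left_mem_uIcc right_mem_uIcc
  have e : γ (s + h) - γ s - h • γ' s = γ (s + h) - (s + h) • γ' s - (γ s - s • γ' s) := by
    rw [add_smul]; abel
  rw [e]
  refine this.trans (le_of_eq ?_)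
  rw [show s + h - s = h by ring, Real.norm_eq_abs, mul_comm]

/-- A locally Lipschitz map is uniformly Lipschitz relative to the points of a compact set. -/
theorem exists_lipschitz_near_compact {E F : Type*} [NormedAddCommGroup E] [NormedAddCommGroup F]
    {G : E → F} {K : Set E} (hK : IsCompact K)
    (hG : ∀ x ∈ K, ∃ L : NNReal, ∃ s ∈ 𝓝 x, LipschitzOnWith L G s) :
    ∃ r > 0, ∃ L : ℝ, 0 ≤ L ∧ ∀ x ∈ K, ∀ y, ‖y - x‖ ≤ r → ‖G y - G x‖ ≤ L * ‖y - x‖ := by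
  refine hK.induction_on (p := fun K => ∃ r > 0, ∃ L : ℝ, 0 ≤ L ∧ ∀ x ∈ K, ∀ y, ‖y - x‖ ≤ r →
    ‖G y - G x‖ ≤ L * ‖y - x‖) ⟨1, one_pos, 0, le_rfl, by simp⟩ ?_ ?_ ?_
  · rintro s t hst ⟨r, hr, L, hL, H⟩
    exact ⟨r, hr, L, hL, fun x hx => H x (hst hx)⟩
  · rintro s t ⟨r, hr, L, hL, H⟩ ⟨r', hr', L', hL', H'⟩
    refine ⟨min r r', lt_min hr hr', max L L', le_max_of_le_left hL, ?_⟩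
    rintro x (hx | hx) y hy
    · exact (H x hx y (hy.trans (min_le_left _ _))).trans (by gcongr; exact le_max_left _ _)
    · exact (H' x hx y (hy.trans (min_le_right _ _))).trans (by gcongr; exact le_max_right _ _)
  · intro x hx
    obtain ⟨L, s, hs, hL⟩ := hG x hx
    obtain ⟨ρ, hρ, hball⟩ := Metric.mem_nhds_iff.1 hs
    -- With `z` within `ρ / 2` of `x` and `y` within `ρ / 4` of `z`, both lie in the ball on which
    -- `G` is Lipschitz.
    refine ⟨Metric.ball x (ρ / 2), mem_nhdsWithin_of_mem_nhds (Metric.ball_mem_nhds _ (by positivity)),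
      ρ / 4, by positivity, L, L.2, fun z hz y hy => ?_⟩
    rw [Metric.mem_ball] at hz
    have hy' : dist y x < ρ := by
      have := dist_triangle y z x
      rw [dist_eq_norm y z] at this
      linarith
    have := hL.dist_le_mul y (hball hy') z (hball (Metric.mem_ball.2 (by linarith)))
    rwa [dist_eq_norm, dist_eq_norm] at this

section SymplecticEuler

variable {E : Type*} [NormedAddCommGroup E] [NormedSpace ℝ E]

/-- One step of the symplectic Euler scheme for `q' = p / m`, `p' = -G q`. -/
def symplecticEuler (m : ℝ) (G : E → E) (h : ℝ) (x : E × E) : E × E :=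
  (x.1 + (h / m) • (x.2 - h • G x.1), x.2 - h • G x.1)

/-- The symplectic Euler scheme converges to every trajectory along which the force is locally
Lipschitz. -/
theorem tendsto_symplecticEuler {m : ℝ} (hm : 0 < m) {G : E → E} {γ : ℝ → E × E}
    (hγ : ∀ t, HasDerivAt γ ((1 / m) • (γ t).2, -G (γ t).1) t)
    (hG : ∀ t, ∃ L : NNReal, ∃ s ∈ 𝓝 (γ t).1, LipschitzOnWith L G s) (t : ℝ) :
    Tendsto (fun n : ℕ => (symplecticEuler m G (t / n))^[n] (γ 0)) atTop (𝓝 (γ t)) := by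
  have hγc : Continuous γ := continuous_iff_continuousAt.2 fun t => (hγ t).continuousAt
  have hGc : Continuous fun t => G (γ t).1 := by
    refine continuous_iff_continuousAt.2 fun t => ?_
    obtain ⟨L, s, hs, hL⟩ := hG t
    have h1 : ContinuousAt G (γ t).1 := hL.continuousOn.continuousAt hs
    exact ContinuousAt.comp (f := fun t => (γ t).1) h1 hγc.fst.continuousAt
  have hγ'c : Continuous fun t => ((1 / m) • (γ t).2, -G (γ t).1) :=
    (hγc.snd.const_smul _).prodMk hGc.neg
  obtain ⟨r, hr, L, hL, HL⟩ := exists_lipschitz_near_compact (G := G)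
    ((isCompact_uIcc (a := (0 : ℝ)) (b := t)).image hγc.fst)
    (by rintro _ ⟨s, _, rfl⟩; exact hG s)
  obtain ⟨B, hB⟩ := (isCompact_uIcc (a := (0 : ℝ)) (b := t)).exists_bound_of_continuousOn
    hGc.continuousOn
  have hB0 : 0 ≤ B := (norm_nonneg _).trans (hB 0 left_mem_uIcc)
  refine tendsto_iterate_of_consistent _ γ t (L + 1 / m) r (by positivity) hr fun ε hε => ?_
  obtain ⟨δ, hδ, hT⟩ := exists_taylor_bound hγ hγ'c t (ε / 2) (by positivity)
  -- In the tube `‖G‖ ≤ B + L * r`, so `D` controls the only second-order term of the scheme, `(h² /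
  -- m) G`, by `|h| * ε / 2` once `|h| ≤ ε / (2D)`.
  set D := (B + L * r) / m + 1 with hD
  have hD0 : 0 < D := by positivity
  refine ⟨min δ (ε / (2 * D)), lt_min hδ (by positivity), fun h hh s hs hsh y hy => ?_⟩
  have hT := hT h (hh.trans (min_le_left _ _)) s hs hsh
  have hhD : |h| * D ≤ ε / 2 := by
    have := hh.trans (min_le_right _ _)
    rw [le_div_iff₀ (by positivity)] at this
    linarith
  have hy1 : ‖y.1 - (γ s).1‖ ≤ ‖y - γ s‖ := norm_fst_le (y - γ s)
  have hy2 : ‖y.2 - (γ s).2‖ ≤ ‖y - γ s‖ := norm_snd_le (y - γ s)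
  have hT1 : ‖(γ (s + h)).1 - (γ s).1 - h • ((1 / m) • (γ s).2)‖ ≤ |h| * (ε / 2) :=
    (norm_fst_le _).trans hT
  have hT2 : ‖(γ (s + h)).2 - (γ s).2 - h • (-G (γ s).1)‖ ≤ |h| * (ε / 2) :=
    (norm_snd_le _).trans hT
  have hGy : ‖G y.1 - G (γ s).1‖ ≤ L * ‖y - γ s‖ :=
    (HL _ ⟨s, hs, rfl⟩ y.1 (hy1.trans hy)).trans (by gcongr)
  have hGn : ‖G y.1‖ ≤ B + L * r := by
    have h1 := norm_le_norm_add_norm_sub' (G y.1) (G (γ s).1)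
    have h2 := hB s hs
    have h3 : L * ‖y - γ s‖ ≤ L * r := by gcongr
    linarith
  have hnn := norm_nonneg (y - γ s)
  rw [Prod.norm_def]
  refine max_le ?_ ?_
  · have e : (symplecticEuler m G h y - γ (s + h)).1
        = (y.1 - (γ s).1) + (h / m) • (y.2 - (γ s).2) - (h * (h / m)) • G y.1
          - ((γ (s + h)).1 - (γ s).1 - h • ((1 / m) • (γ s).2)) := by
      simp only [symplecticEuler, Prod.fst_sub]
      module
    rw [e]
    have b1 : ‖(h / m) • (y.2 - (γ s).2)‖ ≤ |h| * (1 / m) * ‖y - γ s‖ := by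
      rw [norm_smul, Real.norm_eq_abs, abs_div, abs_of_pos hm, div_eq_mul_one_div]
      gcongr
    have b2 : ‖(h * (h / m)) • G y.1‖ ≤ |h| * (ε / 2) := by
      rw [norm_smul, Real.norm_eq_abs, abs_mul, abs_div, abs_of_pos hm, mul_assoc]
      gcongr
      calc |h| / m * ‖G y.1‖ ≤ |h| / m * (B + L * r) := by gcongr
        _ = |h| * ((B + L * r) / m) := by ring
        _ ≤ |h| * D := by gcongr; linarith
        _ ≤ _ := hhD
    have := (norm_sub_le ((y.1 - (γ s).1) + (h / m) • (y.2 - (γ s).2) - (h * (h / m)) • G y.1)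
      ((γ (s + h)).1 - (γ s).1 - h • ((1 / m) • (γ s).2)))
    have t2 := norm_sub_le ((y.1 - (γ s).1) + (h / m) • (y.2 - (γ s).2)) ((h * (h / m)) • G y.1)
    have t3 := norm_add_le (y.1 - (γ s).1) ((h / m) • (y.2 - (γ s).2))
    have : 0 ≤ |h| * L * ‖y - γ s‖ := by positivity
    linarith
  · have e : (symplecticEuler m G h y - γ (s + h)).2
        = (y.2 - (γ s).2) - h • (G y.1 - G (γ s).1)
          - ((γ (s + h)).2 - (γ s).2 - h • (-G (γ s).1)) := by
      simp only [symplecticEuler, Prod.snd_sub]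
      module
    rw [e]
    have b1 : ‖h • (G y.1 - G (γ s).1)‖ ≤ |h| * L * ‖y - γ s‖ := by
      rw [norm_smul, Real.norm_eq_abs, mul_assoc]
      gcongr
    have t1 := norm_sub_le ((y.2 - (γ s).2) - h • (G y.1 - G (γ s).1))
      ((γ (s + h)).2 - (γ s).2 - h • (-G (γ s).1))
    have t2 := norm_sub_le (y.2 - (γ s).2) (h • (G y.1 - G (γ s).1))
    have : 0 ≤ |h| * (1 / m) * ‖y - γ s‖ := by positivity
    have : 0 ≤ |h| * (ε / 2) := by positivity
    linarith

variable [MeasurableSpace E] [BorelSpace E] [SecondCountableTopology E]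

theorem measurable_symplecticEuler (m : ℝ) {G : E → E} (hG : Measurable G) :
    Measurable fun z : ℝ × (E × E) => symplecticEuler m G z.1 z.2 := by
  unfold symplecticEuler
  fun_prop

theorem measurable_symplecticEuler_iterate (m : ℝ) {G : E → E} (hG : Measurable G) (n : ℕ) :
    Measurable fun z : ℝ × (E × E) => (symplecticEuler m G z.1)^[n] z.2 := by
  induction n with
  | zero => exact measurable_snd
  | succ n ih =>
    simp only [Function.iterate_succ_apply']
    exact (measurable_symplecticEuler m hG).comp (measurable_fst.prodMk ih)

/-- A step is a kick of the momentum followed by a drift of the position. Each is a shear, that is,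
a translation in one variable with the other held fixed. -/
theorem measurePreserving_symplecticEuler (μ : Measure E) [SFinite μ] [μ.IsAddLeftInvariant]
    (m : ℝ) {G : E → E} (hG : Measurable G) (h : ℝ) :
    MeasurePreserving (symplecticEuler m G h) (μ.prod μ) (μ.prod μ) := by
  have kick : MeasurePreserving (fun x : E × E => (x.1, x.2 - h • G x.1)) (μ.prod μ) (μ.prod μ) := by
    refine (MeasurePreserving.id μ).skew_product (g := fun q p => p - h • G q) (by fun_prop) ?_
    refine ae_of_all _ fun q => ?_
    simpa only [sub_eq_neg_add] using map_add_left_eq_self μ (-(h • G q))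
  have drift : MeasurePreserving (fun x : E × E => (x.1, x.2 + (h / m) • x.1))
      (μ.prod μ) (μ.prod μ) := by
    refine (MeasurePreserving.id μ).skew_product (g := fun p q => q + (h / m) • p) (by fun_prop) ?_
    refine ae_of_all _ fun q => ?_
    simpa only [add_comm] using map_add_left_eq_self μ ((h / m) • q)
  have sw : MeasurePreserving (Prod.swap : E × E → E × E) (μ.prod μ) (μ.prod μ) :=
    Measure.measurePreserving_swap
  exact (sw.comp drift).comp (sw.comp kick)

end SymplecticEuler

theorem hasDerivAt_fst_comp {E F : Type*} [NormedAddCommGroup E] [NormedSpace ℝ E]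
    [NormedAddCommGroup F] [NormedSpace ℝ F] {γ : ℝ → E × F} {v : E × F} {t : ℝ}
    (h : HasDerivAt γ v t) : HasDerivAt (fun s => (γ s).1) v.1 t :=
  (ContinuousLinearMap.fst ℝ E F).hasFDerivAt.comp_hasDerivAt t h

theorem hasDerivAt_snd_comp {E F : Type*} [NormedAddCommGroup E] [NormedSpace ℝ E]
    [NormedAddCommGroup F] [NormedSpace ℝ F] {γ : ℝ → E × F} {v : E × F} {t : ℝ}
    (h : HasDerivAt γ v t) : HasDerivAt (fun s => (γ s).2) v.2 t :=
  (ContinuousLinearMap.snd ℝ E F).hasFDerivAt.comp_hasDerivAt t h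

/-! ### The Hamiltonian flow: uniqueness, reversibility, energy and volume -/

namespace Model

variable (M : Model)

/-- The gradient of the potential, extended by zero. -/
def force (N : ℕ) : RVec (M.d N) → RVec (M.d N) := (M.V N).indicator (gradient (M.U N))

theorem contDiffOn_gradient (N : ℕ) : ContDiffOn ℝ 1 (gradient (M.U N)) (M.V N) := by
  have h := (M.contDiffOn_U N).fderiv_of_isOpen (m := 1) (M.isOpen_V N) (by norm_num)
  exact (InnerProductSpace.toDual ℝ (RVec (M.d N))).symm.contDiff.comp_contDiffOn h

theorem force_eq {N : ℕ} {q : RVec (M.d N)} (hq : q ∈ M.V N) :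
    M.force N q = gradient (M.U N) q := indicator_of_mem hq _

theorem exists_lipschitzOnWith_force {N : ℕ} {q : RVec (M.d N)} (hq : q ∈ M.V N) :
    ∃ L : NNReal, ∃ s ∈ 𝓝 q, LipschitzOnWith L (M.force N) s := by
  have h : ContDiffAt ℝ 1 (gradient (M.U N)) q :=
    (M.contDiffOn_gradient N).contDiffAt ((M.isOpen_V N).mem_nhds hq)
  have h' : ContDiffAt ℝ 1 (M.force N) q := by
    refine h.congr_of_eventuallyEq ?_
    filter_upwards [(M.isOpen_V N).mem_nhds hq] with y hy using M.force_eq hy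
  exact h'.exists_lipschitzOnWith

theorem measurable_force (N : ℕ) : Measurable (M.force N) := by
  classical
  rw [force, ← piecewise_eq_indicator]
  exact (M.contDiffOn_gradient N).continuousOn.measurable_piecewise continuousOn_const
    (M.isOpen_V N).measurableSet

variable {M}

theorem IsTrajectory.tendsto {N : ℕ} {γ : ℝ → M.QP N} (h : M.IsTrajectory N γ) (t : ℝ) :
    Tendsto (fun n : ℕ => (symplecticEuler M.m (M.force N) (t / n))^[n] (γ 0)) atTop
      (𝓝 (γ t)) :=
  tendsto_symplecticEuler M.m_pos (fun t => by rw [M.force_eq (h t).1]; exact (h t).2)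
    (fun t => M.exists_lipschitzOnWith_force (h t).1) t

/-- The Euler iterates depend only on the initial point, and limits are unique. -/
theorem IsTrajectory.unique {N : ℕ} {γ γ' : ℝ → M.QP N} (h : M.IsTrajectory N γ)
    (h' : M.IsTrajectory N γ') (h0 : γ 0 = γ' 0) : γ = γ' := by
  funext t
  have := h'.tendsto t
  rw [← h0] at this
  exact tendsto_nhds_unique (h.tendsto t) this

theorem IsTrajectory.shift {N : ℕ} {γ : ℝ → M.QP N} (h : M.IsTrajectory N γ) (s : ℝ) :
    M.IsTrajectory N fun t => γ (s + t) := by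
  refine fun t => ⟨(h _).1, ?_⟩
  exact (h (s + t)).2.comp_const_add s t

theorem IsTrajectory.reverse {N : ℕ} {γ : ℝ → M.QP N} (h : M.IsTrajectory N γ) :
    M.IsTrajectory N fun t => ((γ (-t)).1, -(γ (-t)).2) := by
  refine fun t => ⟨(h _).1, ?_⟩
  have h1 : HasDerivAt (fun t => γ (-t)) (-((1 / M.m) • (γ (-t)).2, -gradient (M.U N) (γ (-t)).1))
      t := by
    rw [← neg_one_smul ℝ]
    exact (h (-t)).2.scomp t (hasDerivAt_neg t)
  refine ((hasDerivAt_fst_comp h1).prodMk (hasDerivAt_snd_comp h1).neg).congr_deriv ?_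
  simp

variable (M)

theorem flow_of_notMem {N : ℕ} {x : M.QP N} (hx : x.1 ∉ M.V N) (t : ℝ) : M.flow N t x = x := by
  rw [flow, dif_neg]
  rintro ⟨γ, hγ, rfl⟩
  exact hx (hγ 0).1

variable {M}

theorem isTrajectory_flow (hM : M.Complete) {N : ℕ} {x : M.QP N} (hx : x.1 ∈ M.V N) :
    M.IsTrajectory N (fun t => M.flow N t x) ∧ M.flow N 0 x = x := by
  have h := hM N x hx
  simp only [flow, dif_pos h]
  exact h.choose_spec

theorem IsTrajectory.eq_flow (hM : M.Complete) {N : ℕ} {γ : ℝ → M.QP N} (h : M.IsTrajectory N γ)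
    (t : ℝ) : γ t = M.flow N t (γ 0) := by
  have h' := isTrajectory_flow hM (h 0).1
  exact congrFun (h.unique h'.1 h'.2.symm) t

theorem flow_mem (hM : M.Complete) {N : ℕ} {x : M.QP N} (hx : x.1 ∈ M.V N) (t : ℝ) :
    (M.flow N t x).1 ∈ M.V N := ((isTrajectory_flow hM hx).1 t).1

/-- On the domain this is uniqueness for the shifted trajectory; elsewhere `flow` is the identity,
so that the group law needs no condition on `x`. -/
theorem flow_flow (hM : M.Complete) (N : ℕ) (s t : ℝ) (x : M.QP N) :
    M.flow N t (M.flow N s x) = M.flow N (s + t) x := by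
  by_cases hx : x.1 ∈ M.V N
  · have h := ((isTrajectory_flow hM hx).1.shift s).eq_flow hM t
    simpa using h.symm
  · simp only [M.flow_of_notMem hx]

theorem flow_zero (hM : M.Complete) (N : ℕ) (x : M.QP N) : M.flow N 0 x = x := by
  by_cases hx : x.1 ∈ M.V N
  · exact (isTrajectory_flow hM hx).2
  · exact M.flow_of_notMem hx 0

theorem flow_reverse (hM : M.Complete) (N : ℕ) (t : ℝ) (x : M.QP N) :
    M.flow N t (x.1, -x.2) = ((M.flow N (-t) x).1, -(M.flow N (-t) x).2) := by
  by_cases hx : x.1 ∈ M.V N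
  · have h := (isTrajectory_flow hM hx).1.reverse.eq_flow hM t
    simpa [flow_zero hM] using h.symm
  · rw [M.flow_of_notMem hx, M.flow_of_notMem (x := (x.1, -x.2)) hx]

/-- Conservation of energy. -/
theorem ham_flow (hM : M.Complete) {N : ℕ} {x : M.QP N} (hx : x.1 ∈ M.V N) (t : ℝ) :
    M.ham N (M.flow N t x) = M.ham N x := by
  obtain ⟨h, h0⟩ := isTrajectory_flow hM hx
  set γ := fun t => M.flow N t x with hγ
  have hd : ∀ s, HasDerivAt (fun s => M.ham N (γ s)) 0 s := by
    intro s
    obtain ⟨hm, hs⟩ := h s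
    have hU : DifferentiableAt ℝ (M.U N) (γ s).1 :=
      ((M.contDiffOn_U N).contDiffAt ((M.isOpen_V N).mem_nhds hm)).differentiableAt (by norm_num)
    have h1 : HasDerivAt (fun s => M.U N (γ s).1) _ s :=
      hU.hasGradientAt.hasFDerivAt.comp_hasDerivAt s (hasDerivAt_fst_comp hs)
    have h2 : HasDerivAt (fun s => M.kin (γ s).2) _ s := (hasDerivAt_snd_comp hs).norm_sq.div_const (2 * M.m)
    have h3 := (h1.add h2).add_const (M.d N / (2 * M.β) * Real.log (2 * M.m * Real.pi / M.β))
    refine h3.congr_deriv ?_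
    have := M.m_pos
    -- The terms `⟨∇U, p⟩ / m` from the potential and the kinetic energy cancel.
    simp only [InnerProductSpace.toDual_apply_apply, inner_smul_right, inner_neg_right,
      real_inner_comm (gradient (M.U N) (γ s).1)]
    field_simp
    ring
  have := is_const_of_deriv_eq_zero (fun s => (hd s).differentiableAt) (fun s => (hd s).deriv) t 0
  simpa [hγ, h0] using this

variable (M) in
/-- The position-momentum pairs with position in the configuration domain. -/
def domain (N : ℕ) : Set (M.QP N) := {x | x.1 ∈ M.V N}

theorem measurableSet_domain (N : ℕ) : MeasurableSet (M.domain N) :=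
  measurable_fst (M.isOpen_V N).measurableSet

theorem tendsto_flow (hM : M.Complete) {N : ℕ} {x : M.QP N} (hx : x ∈ M.domain N) (t : ℝ) :
    Tendsto (fun n : ℕ => (symplecticEuler M.m (M.force N) (t / n))^[n] x) atTop
      (𝓝 (M.flow N t x)) := by
  obtain ⟨h, h0⟩ := isTrajectory_flow hM hx
  simpa [h0] using h.tendsto t

/-- Joint measurability in time and state, needed because hitting times depend on the state, is
inherited from the Euler iterates by pointwise convergence. -/
theorem measurable_flow (hM : M.Complete) (N : ℕ) :
    Measurable fun z : ℝ × M.QP N => M.flow N z.1 z.2 := by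
  classical
  refine measurable_of_tendsto_metrizable (f := fun (n : ℕ) (z : ℝ × M.QP N) =>
    if z.2 ∈ M.domain N then (symplecticEuler M.m (M.force N) (z.1 / n))^[n] z.2 else z.2) ?_ ?_
  · intro n
    refine Measurable.ite (measurable_snd (measurableSet_domain N)) ?_ measurable_snd
    exact (measurable_symplecticEuler_iterate M.m (M.measurable_force N) n).comp
      ((measurable_fst.div_const _).prodMk measurable_snd)
  · rw [tendsto_pi_nhds]
    rintro ⟨t, x⟩
    by_cases hx : x ∈ M.domain N
    · simpa [hx] using tendsto_flow hM hx t
    · have hx' : x.1 ∉ M.V N := hx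
      simp [hx, M.flow_of_notMem hx']

theorem measurable_flow_const (hM : M.Complete) (N : ℕ) (t : ℝ) : Measurable (M.flow N t) :=
  (measurable_flow hM N).comp measurable_prodMk_left

/-- Outer regularity reduces this to open sets. For these, Fatou's lemma passes the invariance of
volume from the Euler iterates to their limit, at the price of an inequality. -/
theorem volume_inter_flow_preimage_le (hM : M.Complete) (N : ℕ) (t : ℝ) (A : Set (M.QP N)) :
    volume (M.domain N ∩ M.flow N t ⁻¹' A) ≤ volume A := by
  suffices H : ∀ O : Set (M.QP N), IsOpen O →
      volume (M.domain N ∩ M.flow N t ⁻¹' O) ≤ volume O by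
    rw [Set.measure_eq_iInf_isOpen A]
    refine le_iInf₂ fun O hAO => le_iInf fun hO => le_trans (measure_mono ?_) (H O hO)
    gcongr
  intro O hO
  set S : ℕ → M.QP N → M.QP N := fun n => (symplecticEuler M.m (M.force N) (t / n))^[n]
  have hS : ∀ n, MeasurePreserving (S n) volume volume := fun n =>
    (measurePreserving_symplecticEuler volume M.m (M.measurable_force N) (t / n)).iterate n
  have hD : MeasurableSet (M.domain N ∩ M.flow N t ⁻¹' O) :=
    (measurableSet_domain N).inter (measurable_flow_const hM N t hO.measurableSet)
  calc volume (M.domain N ∩ M.flow N t ⁻¹' O)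
      = ∫⁻ x, (M.domain N ∩ M.flow N t ⁻¹' O).indicator 1 x := by rw [lintegral_indicator_one hD]
    _ ≤ ∫⁻ x, liminf (fun n => O.indicator (1 : M.QP N → ℝ≥0∞) (S n x)) atTop := by
        refine lintegral_mono fun x => ?_
        by_cases hx : x ∈ M.domain N ∩ M.flow N t ⁻¹' O
        swap
        · rw [indicator_of_notMem hx]
          exact zero_le
        rw [indicator_of_mem hx]
        -- Since `O` is open and contains the limit, the iterates are eventually in `O`.
        refine le_liminf_of_le (by isBoundedDefault) ?_
        filter_upwards [(tendsto_flow hM hx.1 t).eventually (hO.mem_nhds hx.2)] with n hn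
        rw [indicator_of_mem hn]
        exact le_rfl
    _ ≤ liminf (fun n => ∫⁻ x, O.indicator (1 : M.QP N → ℝ≥0∞) (S n x)) atTop :=
        lintegral_liminf_le fun n =>
          (measurable_one.indicator hO.measurableSet).comp (hS n).measurable
    _ = volume O := by
        have : ∀ n, ∫⁻ x, O.indicator (1 : M.QP N → ℝ≥0∞) (S n x) = volume O := fun n => by
          rw [(hS n).lintegral_comp (measurable_one.indicator hO.measurableSet),
            lintegral_indicator_one hO.measurableSet]
        simp [this]

/-- Liouville's theorem. -/
theorem measurePreserving_flow (hM : M.Complete) (N : ℕ) (t : ℝ) :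
    MeasurePreserving (M.flow N t) (volume.restrict (M.domain N))
      (volume.restrict (M.domain N)) := by
  have hle : ∀ (t : ℝ) (A : Set (M.QP N)), MeasurableSet A →
      volume.restrict (M.domain N) (M.flow N t ⁻¹' A) ≤ volume.restrict (M.domain N) A := by
    intro t A hA
    rw [Measure.restrict_apply (measurable_flow_const hM N t hA), Measure.restrict_apply hA]
    refine le_trans (measure_mono ?_) (volume_inter_flow_preimage_le hM N t (A ∩ M.domain N))
    exact fun x hx => ⟨hx.2, hx.1, flow_mem hM hx.2 t⟩
  refine ⟨measurable_flow_const hM N t, Measure.ext fun A hA => ?_⟩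
  rw [Measure.map_apply (measurable_flow_const hM N t) hA]
  -- The opposite inequality is the same one for time `-t`, applied to the preimage of `A`.
  refine le_antisymm (hle t A hA) ?_
  calc volume.restrict (M.domain N) A
      = volume.restrict (M.domain N) (M.flow N (-t) ⁻¹' (M.flow N t ⁻¹' A)) := by
        congr 1; ext x; simp [flow_flow hM, flow_zero hM]
    _ ≤ _ := hle (-t) _ (measurable_flow_const hM N t hA)

end Model

/-! ### Concatenation of vectors -/

theorem measurable_toLp_comp {α : Type*} [MeasurableSpace α] {k : ℕ} {f : α → Fin k → ℝ}
    (hf : ∀ i, Measurable fun a => f a i) : Measurable fun a => (WithLp.toLp 2 (f a) : RVec k) :=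
  (PiLp.volume_preserving_toLp (Fin k)).measurable.comp (measurable_pi_lambda f hf)

theorem measurable_coord {k : ℕ} (i : Fin k) : Measurable fun v : RVec k => v i :=
  (measurable_pi_apply i).comp (PiLp.volume_preserving_ofLp (Fin k)).measurable

theorem measurable_head {a b : ℕ} (h : a ≤ b) : Measurable (head h) :=
  measurable_toLp_comp fun _ => measurable_coord _

theorem measurable_tail {a b : ℕ} : Measurable (tail : RVec b → RVec (b - a)) :=
  measurable_toLp_comp fun _ => measurable_coord _

theorem head_append {a b : ℕ} (h : a ≤ b) (v : RVec a) (w : RVec (b - a)) :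
    head h (append v w) = v := by
  ext i
  simp [head, append]

theorem tail_append {a b : ℕ} (v : RVec a) (w : RVec (b - a)) :
    tail (append v w) = w := by
  ext i
  simp [tail, append]

theorem head_neg {a b : ℕ} (h : a ≤ b) (v : RVec b) : head h (-v) = -head h v := by
  ext i
  simp [head]

theorem tail_neg {a b : ℕ} (v : RVec b) : (tail (-v) : RVec (b - a)) = -tail v := by
  ext i
  simp [tail]

theorem append_neg {a b : ℕ} (v : RVec a) (w : RVec (b - a)) :
    append (-v) (-w) = -append v w := by
  ext i
  simp only [append, PiLp.neg_apply]
  split_ifs <;> rfl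

theorem measurePreserving_append {a b : ℕ} (h : a ≤ b) :
    MeasurePreserving fun z : RVec a × RVec (b - a) => append z.1 z.2 := by
  let e : Fin a ⊕ Fin (b - a) ≃ Fin b := finSumFinEquiv.trans (finCongr (by omega))
  have h1 : MeasurePreserving (Prod.map (WithLp.ofLp : RVec a → _) (WithLp.ofLp : RVec (b - a) → _))
      volume volume :=
    (PiLp.volume_preserving_ofLp (Fin a)).prod (PiLp.volume_preserving_ofLp (Fin (b - a)))
  have h2 := volume_measurePreserving_sumPiEquivProdPi_symm fun _ : Fin a ⊕ Fin (b - a) => ℝ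
  have h3 := volume_measurePreserving_piCongrLeft (fun _ : Fin b => ℝ) e
  have h4 := PiLp.volume_preserving_toLp (Fin b)
  have heq : (fun z : RVec a × RVec (b - a) => append z.1 z.2) =
      WithLp.toLp 2 ∘ MeasurableEquiv.piCongrLeft (fun _ : Fin b => ℝ) e ∘
        (MeasurableEquiv.sumPiEquivProdPi fun _ : Fin a ⊕ Fin (b - a) => ℝ).symm ∘
        Prod.map WithLp.ofLp WithLp.ofLp := by
    funext z
    ext i
    obtain ⟨j, rfl⟩ := e.surjective i
    simp only [Function.comp_apply, MeasurableEquiv.coe_piCongrLeft,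
      Equiv.piCongrLeft_apply_apply]
    rcases j with j | j
    · simp [append, e, MeasurableEquiv.coe_sumPiEquivProdPi_symm]
    · simp [append, e, MeasurableEquiv.coe_sumPiEquivProdPi_symm]
  rw [heq]
  exact h4.comp (h3.comp (h2.comp h1))

theorem measurePreserving_prodProdProdComm {α β γ δ : Type*} [MeasureSpace α] [MeasureSpace β]
    [MeasureSpace γ] [MeasureSpace δ] [SigmaFinite (volume : Measure α)]
    [SigmaFinite (volume : Measure β)] [SigmaFinite (volume : Measure γ)]
    [SigmaFinite (volume : Measure δ)] :
    MeasurePreserving fun z : (α × β) × (γ × δ) => ((z.1.1, z.2.1), (z.1.2, z.2.2)) := by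
  have h1 := volume_preserving_prodAssoc (α₁ := α) (β₁ := β) (γ₁ := γ × δ)
  have h2 := (volume_preserving_prodAssoc (α₁ := β) (β₁ := γ) (γ₁ := δ)).symm
  have h3 : MeasurePreserving (Prod.map (Prod.swap : β × γ → γ × β) (id : δ → δ)) :=
    Measure.measurePreserving_swap.prod (MeasurePreserving.id volume)
  have h4 := volume_preserving_prodAssoc (α₁ := γ) (β₁ := β) (γ₁ := δ)
  have h5 : MeasurePreserving (Prod.map (id : α → α) _) volume volume :=
    (MeasurePreserving.id volume).prod (h4.comp (h3.comp h2))
  have h6 := (volume_preserving_prodAssoc (α₁ := α) (β₁ := γ) (γ₁ := β × δ)).symm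
  exact h6.comp (h5.comp h1)

/-! ### Measurability on countable disjoint unions -/

theorem measurable_of_sigma {ι γ : Type*} {β : ι → Type*} [∀ i, MeasurableSpace (β i)]
    [MeasurableSpace γ] {f : (Σ i, β i) → γ} (h : ∀ i, Measurable fun z => f ⟨i, z⟩) :
    Measurable f :=
  fun _ hs => MeasurableSpace.measurableSet_iInf.2 fun i => h i hs

theorem measurable_sigmaMk {ι : Type*} {β : ι → Type*} [∀ i, MeasurableSpace (β i)] (i : ι) :
    Measurable (Sigma.mk i : β i → Σ i, β i) :=
  fun _ hs => MeasurableSpace.measurableSet_iInf.1 hs i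

theorem measurableEmbedding_sigmaMk {ι : Type*} {β : ι → Type*} [∀ i, MeasurableSpace (β i)]
    (i : ι) : MeasurableEmbedding (Sigma.mk i : β i → Σ i, β i) := by
  refine ⟨sigma_mk_injective, measurable_sigmaMk i, fun s hs => ?_⟩
  refine MeasurableSpace.measurableSet_iInf.2 fun j => ?_
  change MeasurableSet (Sigma.mk j ⁻¹' (Sigma.mk i '' s))
  by_cases hij : j = i
  · subst hij
    rwa [preimage_image_eq _ sigma_mk_injective]
  · rw [preimage_image_sigmaMk_of_ne hij]
    exact MeasurableSet.empty

/-- A preimage is the countable union of its parts over the components, each the image of a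
measurable set under a measurable embedding. -/
theorem measurable_of_prod_sigma {α ι γ : Type*} [Countable ι] {β : ι → Type*}
    [MeasurableSpace α] [∀ i, MeasurableSpace (β i)] [MeasurableSpace γ]
    {f : α × (Σ i, β i) → γ} (h : ∀ i, Measurable fun z : α × β i => f (z.1, ⟨i, z.2⟩)) :
    Measurable f := by
  intro s hs
  have : f ⁻¹' s = ⋃ i, Prod.map id (Sigma.mk i) '' ((fun z : α × β i => f (z.1, ⟨i, z.2⟩)) ⁻¹' s) := by
    ext ⟨a, i, b⟩
    simp only [mem_preimage, mem_iUnion, mem_image, Prod.exists, Prod.map_apply, id]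
    constructor
    · intro hf
      exact ⟨i, a, b, hf, rfl⟩
    · rintro ⟨j, a', b', hf, heq⟩
      rw [← heq]
      exact hf
  rw [this]
  exact MeasurableSet.iUnion fun i =>
    (MeasurableEmbedding.id.prodMap (measurableEmbedding_sigmaMk i)).measurableSet_image.2 (h i hs)

/-! ### Measurability of the dynamics and the explicit form of the kernel -/

namespace Model

/-- Regularity off the configuration domains, where the data of a model play no role. -/
structure Regular (M : Model) : Prop where
  measurable_U : ∀ N, Measurable (M.U N)
  ins_eq_zero : ∀ N w x, x.1 ∉ M.V N → M.ins N w x = 0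

variable {M : Model}

variable (M) in
/-- The coordinates `(q_new, p_new)` that an insertion adds at index `N`. -/
abbrev New (N : ℕ) : Type := RVec (M.d (N + 1) - M.d N) × RVec (M.d (N + 1) - M.d N)

theorem measurable_kin {k : ℕ} : Measurable (M.kin : RVec k → ℝ) := by
  unfold kin; fun_prop

theorem measurable_kinN : Measurable M.kinN := by
  unfold kinN; fun_prop

theorem measurable_sgn : Measurable sgn :=
  Measurable.ite measurableSet_Ici measurable_const measurable_const

theorem measurable_truncate (N : ℕ) : Measurable (M.truncate N) :=
  ((measurable_head _).comp measurable_fst).prodMk ((measurable_head _).comp measurable_snd)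

theorem measurable_removed (N : ℕ) : Measurable (M.removed N) :=
  (measurable_tail.comp measurable_fst).prodMk (measurable_tail.comp measurable_snd)

/-- Insertions preserve the volume. -/
theorem measurePreserving_extend (N : ℕ) :
    MeasurePreserving fun z : M.QP N × M.New N => M.extend N z.1 z.2 := by
  have h := measurePreserving_append (M.d_strictMono N.lt_succ_self).le
  have h2 : MeasurePreserving (Prod.map _ _) volume volume := h.prod h
  exact h2.comp measurePreserving_prodProdProdComm

theorem measurable_extend (N : ℕ) :
    Measurable fun z : M.QP N × M.New N => M.extend N z.1 z.2 :=
  (measurePreserving_extend N).measurable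

theorem truncate_extend (N : ℕ) (x : M.QP N) (w : M.New N) :
    M.truncate N (M.extend N x w) = x := by
  simp [truncate, extend, head_append]

theorem removed_extend (N : ℕ) (x : M.QP N) (w : M.New N) :
    M.removed N (M.extend N x w) = w := by
  simp [removed, extend, tail_append]

/-- This makes a deletion undo the insertion of the same coordinates, including its effect on `p_n`.
-/
theorem barrierDown_extend (N : ℕ) (x : M.QP N) (w : M.New N) :
    M.barrierDown N (M.extend N x w) = -M.barrierUp N x w := by
  simp only [barrierDown, barrierUp, truncate_extend, removed_extend]
  ring

theorem measurable_ins_swap (N : ℕ) :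
    Measurable fun z : M.QP N × M.New N => M.ins N z.2 z.1 :=
  (Model.measurable_ins M N).comp measurable_swap

theorem Regular.measurable_ham (hR : M.Regular) (N : ℕ) : Measurable (M.ham N) :=
  (((hR.measurable_U N).comp measurable_fst).add (measurable_kin.comp measurable_snd)).add_const _

theorem Regular.measurable_barrierUp (hR : M.Regular) (N : ℕ) :
    Measurable fun z : M.QP N × M.New N => M.barrierUp N z.1 z.2 := by
  unfold barrierUp
  have h1 := (hR.measurable_ham (N + 1)).comp (measurable_extend (M := M) N)
  have h2 := (hR.measurable_ham N).comp (measurable_fst : Measurable fun z : M.QP N × M.New N => z.1)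
  exact (h1.sub h2).add ((Real.measurable_log.comp (measurable_ins_swap N)).const_mul _)

theorem Regular.measurable_barrierDown (hR : M.Regular) (N : ℕ) :
    Measurable (M.barrierDown N) := by
  unfold barrierDown
  have h1 := (hR.measurable_ham N).comp (measurable_truncate (M := M) N)
  have h3 := (measurable_ins_swap N).comp
    ((measurable_truncate (M := M) N).prodMk (measurable_removed (M := M) N))
  exact (h1.sub (hR.measurable_ham (N + 1))).sub ((Real.measurable_log.comp h3).const_mul _)

theorem Regular.measurable_afterInsertion (hR : M.Regular) (N : ℕ) :
    Measurable fun z : (M.QP N × (ℝ × ℝ)) × M.New N =>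
      M.afterInsertion N z.1.1 z.1.2.1 z.1.2.2 z.2 := by
  classical
  have hxw : Measurable fun z : (M.QP N × (ℝ × ℝ)) × M.New N => (z.1.1, z.2) := by fun_prop
  have hb := (hR.measurable_barrierUp N).comp hxw
  have hpn : Measurable fun z : (M.QP N × (ℝ × ℝ)) × M.New N => z.1.2.2 := by fun_prop
  have hn : Measurable fun z : (M.QP N × (ℝ × ℝ)) × M.New N => z.1.2.1 := by fun_prop
  refine Measurable.ite (measurableSet_le hb (measurable_kinN.comp hpn)) ?_ ?_
  · refine (measurable_sigmaMk (β := fun N => M.QP N × (ℝ × ℝ)) (N + 1)).comp ?_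
    refine ((measurable_extend N).comp hxw).prodMk (hn.prodMk ?_)
    exact hpn.sub ((measurable_sgn.comp hpn).mul (hb.const_mul _))
  · refine (measurable_sigmaMk (β := fun N => M.QP N × (ℝ × ℝ)) N).comp ?_
    fun_prop

theorem Regular.measurable_afterDeletion (hR : M.Regular) (N : ℕ) :
    Measurable fun z : M.QP N × (ℝ × ℝ) => M.afterDeletion N z.1 z.2.1 z.2.2 := by
  classical
  have hrej : ∀ N, Measurable fun z : M.QP N × (ℝ × ℝ) =>
      (⟨N, (z.1, (z.2.1, -z.2.2))⟩ : M.State) := fun N =>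
    (measurable_sigmaMk (β := fun N => M.QP N × (ℝ × ℝ)) N).comp (by fun_prop)
  cases N with
  | zero => exact hrej 0
  | succ N =>
    have hx : Measurable fun z : M.QP (N + 1) × (ℝ × ℝ) => z.1 := measurable_fst
    have hpn : Measurable fun z : M.QP (N + 1) × (ℝ × ℝ) => z.2.2 := by fun_prop
    have hb := (hR.measurable_barrierDown N).comp hx
    have hi := (measurable_ins_swap N).comp
      (((measurable_truncate (M := M) N).comp hx).prodMk ((measurable_removed (M := M) N).comp hx))
    refine Measurable.ite ((measurableSet_lt measurable_const hi).inter
      (measurableSet_le hb (measurable_kinN.comp hpn))) ?_ (hrej _)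
    refine (measurable_sigmaMk (β := fun N => M.QP N × (ℝ × ℝ)) N).comp ?_
    refine ((measurable_truncate N).comp hx).prodMk (Measurable.prodMk (by fun_prop) ?_)
    exact hpn.sub ((measurable_sgn.comp hpn).mul (hb.const_mul _))

theorem measurable_freeMove (hM : M.Complete) :
    Measurable fun z : ℝ × M.State => M.freeMove z.1 z.2 := by
  refine measurable_of_prod_sigma fun N => ?_
  refine (measurable_sigmaMk (β := fun N => M.QP N × (ℝ × ℝ)) N).comp ?_
  have hpn : Measurable fun z : ℝ × (M.QP N × (ℝ × ℝ)) => z.2.2.2 := by fun_prop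
  have h1 : Measurable fun z : ℝ × (M.QP N × (ℝ × ℝ)) => M.flow N z.1 z.2.1 :=
    (measurable_flow hM N).comp (by fun_prop : Measurable fun z : ℝ × (M.QP N × (ℝ × ℝ)) =>
      (z.1, z.2.1))
  have h2 := (measurable_sgn.comp hpn).div_const M.mn
  have h3 : Measurable fun z : ℝ × (M.QP N × (ℝ × ℝ)) => z.2.2.1 := by fun_prop
  exact h1.prodMk ((h3.add (measurable_fst.mul h2)).prodMk hpn)

theorem measurable_hitTime : Measurable M.hitTime := by
  refine measurable_of_sigma fun N => ?_
  have hpn : Measurable fun z : M.QP N × (ℝ × ℝ) => z.2.2 := by fun_prop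
  have hn : Measurable fun z : M.QP N × (ℝ × ℝ) => z.2.1 := by fun_prop
  exact Measurable.ite (measurableSet_le measurable_const hpn)
    (((measurable_const (a := (N : ℝ) + 1)).sub hn).const_mul _) ((hn.sub_const (N : ℝ)).const_mul _)

theorem measurable_flip : Measurable M.flip := by
  refine measurable_of_sigma fun N => ?_
  exact (measurable_sigmaMk (β := fun N => M.QP N × (ℝ × ℝ)) N).comp
    (by fun_prop : Measurable fun z : M.QP N × (ℝ × ℝ) => ((z.1.1, -z.1.2), (z.2.1, -z.2.2)))

theorem flip_flip (s : M.State) : M.flip (M.flip s) = s := by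
  obtain ⟨N, ⟨q, p⟩, n, pn⟩ := s
  change (⟨N, ((q, - -p), (n, - -pn))⟩ : M.State) = _
  rw [neg_neg, neg_neg]

theorem jump_of_nonneg (N : ℕ) (x : M.QP N) (n : ℝ) {pn : ℝ} (h : 0 ≤ pn) :
    M.jump ⟨N, (x, (n, pn))⟩ = (volume.withDensity fun w =>
      ENNReal.ofReal (M.ins N w x)).map (M.afterInsertion N x n pn) := if_pos h

theorem jump_of_neg (N : ℕ) (x : M.QP N) (n : ℝ) {pn : ℝ} (h : ¬0 ≤ pn) :
    M.jump ⟨N, (x, (n, pn))⟩ = Measure.dirac (M.afterDeletion N x n pn) := if_neg h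

theorem measurable_ofReal_ins (N : ℕ) (x : M.QP N) :
    Measurable fun w : M.New N => ENNReal.ofReal (M.ins N w x) :=
  ENNReal.measurable_ofReal.comp (Model.measurable_ins M N).of_uncurry_right

theorem Regular.measurable_afterInsertion_right (hR : M.Regular) (N : ℕ) (x : M.QP N) (n pn : ℝ) :
    Measurable fun w : M.New N => M.afterInsertion N x n pn w := by
  have h : Measurable fun w : M.New N => ((x, ((n, pn) : ℝ × ℝ)), w) := measurable_prodMk_left
  have h2 := (hR.measurable_afterInsertion N).comp h
  exact h2

theorem Regular.lintegral_jump (hR : M.Regular) {φ : M.State → ℝ≥0∞} (hφ : Measurable φ) (N : ℕ)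
    (z : M.QP N × (ℝ × ℝ)) :
    ∫⁻ s, φ s ∂M.jump ⟨N, z⟩ = if 0 ≤ z.2.2 then
      ∫⁻ w, ENNReal.ofReal (M.ins N w z.1) * φ (M.afterInsertion N z.1 z.2.1 z.2.2 w)
      else φ (M.afterDeletion N z.1 z.2.1 z.2.2) := by
  split_ifs with h
  · rw [show M.jump ⟨N, z⟩ = _ from jump_of_nonneg N z.1 z.2.1 h,
      lintegral_map hφ (hR.measurable_afterInsertion_right N z.1 z.2.1 z.2.2)]
    exact lintegral_withDensity_eq_lintegral_mul _ (measurable_ofReal_ins N z.1)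
      (hφ.comp (hR.measurable_afterInsertion_right N z.1 z.2.1 z.2.2))
  · rw [show M.jump ⟨N, z⟩ = _ from jump_of_neg N z.1 z.2.1 h, lintegral_dirac' _ hφ]

theorem Regular.measurable_lintegral_jump (hR : M.Regular) {φ : M.State → ℝ≥0∞}
    (hφ : Measurable φ) : Measurable fun s => ∫⁻ s', φ s' ∂M.jump s := by
  refine measurable_of_sigma fun N => ?_
  simp only [hR.lintegral_jump hφ]
  refine Measurable.ite (measurableSet_le measurable_const (by fun_prop)) ?_
    (hφ.comp (hR.measurable_afterDeletion N))
  refine Measurable.lintegral_prod_right' (f := fun p : (M.QP N × (ℝ × ℝ)) × M.New N =>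
    ENNReal.ofReal (M.ins N p.2 p.1.1) * φ (M.afterInsertion N p.1.1 p.1.2.1 p.1.2.2 p.2)) ?_
  refine Measurable.mul ?_ (hφ.comp (hR.measurable_afterInsertion N))
  have hxw : Measurable fun p : (M.QP N × (ℝ × ℝ)) × M.New N => (p.1.1, p.2) := by fun_prop
  exact ((measurable_ins_swap N).comp hxw).ennreal_ofReal

theorem Regular.measurable_jump (hR : M.Regular) : Measurable M.jump := by
  refine Measure.measurable_of_measurable_coe _ fun B hB => ?_
  simpa only [lintegral_indicator_one hB] using
    hR.measurable_lintegral_jump (measurable_one.indicator hB)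

theorem Regular.jump_univ (hR : M.Regular) {N : ℕ} {z : M.QP N × (ℝ × ℝ)} (hz : z.1.1 ∈ M.V N) :
    M.jump ⟨N, z⟩ univ = 1 := by
  rw [← lintegral_one, hR.lintegral_jump measurable_const]
  split_ifs
  · simpa using M.lintegral_ins N z.1 hz
  · rfl

/-- Insertion densities are normalized only on the domains. Their vanishing elsewhere bounds the
mass everywhere, so that `jump` is a finite kernel on all states. -/
theorem Regular.jump_univ_le (hR : M.Regular) (s : M.State) : M.jump s univ ≤ 1 := by
  obtain ⟨N, z⟩ := s
  by_cases hz : z.1.1 ∈ M.V N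
  · exact (hR.jump_univ hz).le
  · rw [← lintegral_one, hR.lintegral_jump measurable_const]
    split_ifs
    · simp [hR.ins_eq_zero N _ _ hz]
    · exact le_rfl

/-- The law of the state after a crossing, as a kernel. -/
def Regular.jumpKernel (hR : M.Regular) : Kernel M.State M.State := ⟨M.jump, hR.measurable_jump⟩

instance (hR : M.Regular) : IsFiniteKernel hR.jumpKernel :=
  ⟨⟨1, ENNReal.one_lt_top, hR.jump_univ_le⟩⟩

theorem Regular.measurable_lintegral_jump_uncurry (hR : M.Regular) {α : Type*} [MeasurableSpace α]
    {g : α → M.State} (hg : Measurable g) {φ : α → M.State → ℝ≥0∞}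
    (hφ : Measurable (Function.uncurry φ)) :
    Measurable fun a => ∫⁻ s', φ a s' ∂M.jump (g a) :=
  Measurable.lintegral_kernel_prod_right (κ := hR.jumpKernel.comap g hg) hφ

/-- Here `⌊T / m_n⌋ = 0`, so the recursion processes a single hit and ends with free motion. -/
theorem kernel_eq (hmn : M.mn = 1) {T : ℝ} (hT1 : T < 1) (s : M.State) :
    M.kernel T s = if M.hitTime s ≤ T then
      (M.jump (M.freeMove (M.hitTime s) s)).bind
        fun s' => Measure.dirac (M.freeMove (T - M.hitTime s) s')
      else Measure.dirac (M.freeMove T s) := by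
  have : ⌊T / M.mn⌋₊ = 0 := by
    rw [hmn, div_one, Nat.floor_eq_zero]; exact hT1
  rw [kernel, this]
  rfl

theorem measurable_freeMove_const (hM : M.Complete) (t : ℝ) : Measurable (M.freeMove t) :=
  (measurable_freeMove hM).comp measurable_prodMk_left

theorem lintegral_kernel (hM : M.Complete) (hmn : M.mn = 1) {T : ℝ} (hT1 : T < 1)
    (s : M.State) {φ : M.State → ℝ≥0∞} (hφ : Measurable φ) :
    ∫⁻ s', φ s' ∂M.kernel T s = if M.hitTime s ≤ T then
      ∫⁻ s', φ (M.freeMove (T - M.hitTime s) s') ∂M.jump (M.freeMove (M.hitTime s) s)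
      else φ (M.freeMove T s) := by
  rw [kernel_eq hmn hT1]
  split_ifs
  · have hd : Measurable fun s' => Measure.dirac (M.freeMove (T - M.hitTime s) s') :=
      Measure.measurable_dirac.comp (measurable_freeMove_const hM _)
    rw [Measure.lintegral_bind hd.aemeasurable hφ.aemeasurable]
    simp only [lintegral_dirac' _ hφ]
  · rw [lintegral_dirac' _ hφ]

theorem measurable_freeMove_hitTime (hM : M.Complete) :
    Measurable fun s => M.freeMove (M.hitTime s) s :=
  (measurable_freeMove hM).comp (measurable_hitTime.prodMk measurable_id)

theorem Regular.measurable_kernel (hR : M.Regular) (hM : M.Complete) (hmn : M.mn = 1) {T : ℝ}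
    (hT1 : T < 1) : Measurable (M.kernel T) := by
  refine Measure.measurable_of_measurable_coe _ fun B hB => ?_
  have h1 : Measurable (B.indicator (1 : M.State → ℝ≥0∞)) := measurable_one.indicator hB
  simp only [← lintegral_indicator_one hB, lintegral_kernel hM hmn hT1 _ h1]
  refine Measurable.ite (measurableSet_le measurable_hitTime measurable_const) ?_
    (h1.comp (measurable_freeMove_const hM T))
  refine hR.measurable_lintegral_jump_uncurry (measurable_freeMove_hitTime hM)
    (φ := fun s s' => B.indicator 1 (M.freeMove (T - M.hitTime s) s')) ?_
  have h2 : Measurable fun p : M.State × M.State => (T - M.hitTime p.1, p.2) :=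
    (measurable_const.sub (measurable_hitTime.comp measurable_fst)).prodMk measurable_snd
  exact h1.comp ((measurable_freeMove hM).comp h2)

theorem Regular.isProbabilityMeasure_kernel (hR : M.Regular) (hM : M.Complete) (hmn : M.mn = 1)
    {T : ℝ} (hT1 : T < 1) {s : M.State} (hs : s ∈ M.phaseSpace) :
    IsProbabilityMeasure (M.kernel T s) := by
  refine ⟨?_⟩
  rw [← lintegral_one, lintegral_kernel hM hmn hT1 s measurable_const, lintegral_one]
  split_ifs
  · exact hR.jump_univ (flow_mem hM hs.1 _)
  · rfl

end Model

/-! ### Momentum reversal and the Gibbs measures -/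

/-- Reversal of the momentum. -/
def reverse {k : ℕ} (x : RVec k × RVec k) : RVec k × RVec k := (x.1, -x.2)

theorem reverse_reverse {k : ℕ} (x : RVec k × RVec k) : reverse (reverse x) = x := by
  simp [reverse]

theorem measurePreserving_reverse {k : ℕ} :
    MeasurePreserving (reverse : RVec k × RVec k → RVec k × RVec k) :=
  (MeasurePreserving.id volume).prod (Measure.measurePreserving_neg volume)

namespace Model

variable {M : Model}

variable (M) in
/-- The Boltzmann weight `e^{-β H_N}` on the domain. -/
def weight (N : ℕ) : M.QP N → ℝ≥0∞ :=
  (M.domain N).indicator fun x => ENNReal.ofReal (Real.exp (-M.β * M.ham N x))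

variable (M) in
/-- The measure `e^{-β H_N(q, p)} dq dp`. -/
def posLaw (N : ℕ) : Measure (M.QP N) := volume.withDensity (M.weight N)

variable (M) in
/-- The measure `e^{-β K_n(p_n)} dp_n`. -/
def momLaw : Measure ℝ :=
  volume.withDensity fun pn => ENNReal.ofReal (Real.exp (-M.β * M.kinN pn))

instance (N : ℕ) : SFinite (M.posLaw N) := by unfold posLaw; infer_instance

instance : SFinite M.momLaw := by unfold momLaw; infer_instance

theorem measurable_momWeight :
    Measurable fun pn => ENNReal.ofReal (Real.exp (-M.β * M.kinN pn)) :=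
  ((measurable_kinN.const_mul _).exp).ennreal_ofReal

theorem Regular.measurable_weight (hR : M.Regular) (N : ℕ) : Measurable (M.weight N) :=
  (((hR.measurable_ham N).const_mul _).exp.ennreal_ofReal).indicator (measurableSet_domain N)

theorem Regular.lintegral_posLaw (hR : M.Regular) (N : ℕ) {φ : M.QP N → ℝ≥0∞} (hφ : Measurable φ) :
    ∫⁻ x, φ x ∂M.posLaw N = ∫⁻ x, M.weight N x * φ x :=
  lintegral_withDensity_eq_lintegral_mul _ (hR.measurable_weight N) hφ

theorem setLIntegral_momLaw {φ : ℝ → ℝ≥0∞} (hφ : Measurable φ) {s : Set ℝ}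
    (hs : MeasurableSet s) :
    ∫⁻ pn in s, φ pn ∂M.momLaw =
      ∫⁻ pn in s, ENNReal.ofReal (Real.exp (-M.β * M.kinN pn)) * φ pn := by
  rw [momLaw, restrict_withDensity hs,
    lintegral_withDensity_eq_lintegral_mul _ measurable_momWeight hφ]
  rfl

theorem measurePreserving_neg_momLaw : MeasurePreserving Neg.neg M.momLaw M.momLaw := by
  refine ⟨measurable_neg, Measure.ext fun s hs => ?_⟩
  rw [Measure.map_apply measurable_neg hs, momLaw, withDensity_apply _ hs,
    withDensity_apply _ (measurable_neg hs), ← (Measure.measurePreserving_neg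
      (volume : Measure ℝ)).setLIntegral_comp_preimage hs measurable_momWeight]
  simp [kinN]

theorem kin_neg {k : ℕ} (p : RVec k) : M.kin (-p) = M.kin p := by
  simp [kin]

theorem ham_reverse (N : ℕ) (x : M.QP N) : M.ham N (reverse x) = M.ham N x := by
  simp [ham, reverse, kin_neg]

theorem extend_reverse (N : ℕ) (x : M.QP N) (w : M.New N) :
    M.extend N (reverse x) (reverse w) = reverse (M.extend N x w) := by
  simp [extend, reverse, append_neg]

theorem truncate_reverse (N : ℕ) (x : M.QP (N + 1)) :
    M.truncate N (reverse x) = reverse (M.truncate N x) := by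
  simp [truncate, reverse, head_neg]

theorem removed_reverse (N : ℕ) (x : M.QP (N + 1)) :
    M.removed N (reverse x) = reverse (M.removed N x) := by
  simp [removed, reverse, tail_neg]

theorem weight_reverse (N : ℕ) (x : M.QP N) : M.weight N (reverse x) = M.weight N x := by
  have h : reverse x ∈ M.domain N ↔ x ∈ M.domain N := Iff.rfl
  by_cases hx : x ∈ M.domain N
  · rw [weight, indicator_of_mem hx, indicator_of_mem (h.2 hx), ham_reverse]
  · rw [weight, indicator_of_notMem hx, indicator_of_notMem (mt h.1 hx)]

theorem Regular.measurePreserving_reverse_posLaw (hR : M.Regular) (N : ℕ) :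
    MeasurePreserving (reverse : M.QP N → M.QP N) (M.posLaw N) (M.posLaw N) := by
  refine ⟨measurePreserving_reverse.measurable, Measure.ext fun s hs => ?_⟩
  rw [Measure.map_apply measurePreserving_reverse.measurable hs, posLaw, withDensity_apply _ hs,
    withDensity_apply _ (measurePreserving_reverse.measurable hs),
    ← measurePreserving_reverse.setLIntegral_comp_preimage hs (hR.measurable_weight N)]
  simp only [weight_reverse]

/-- Liouville's theorem on the domain, combined with the constancy of the density along
trajectories. -/
theorem Regular.measurePreserving_flow_posLaw (hR : M.Regular) (hM : M.Complete) (N : ℕ) (t : ℝ) :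
    MeasurePreserving (M.flow N t) (M.posLaw N) (M.posLaw N) := by
  have hD := measurableSet_domain (M := M) N
  have hf := measurable_flow_const hM N t
  have hw : Measurable fun x => ENNReal.ofReal (Real.exp (-M.β * M.ham N x)) :=
    ((hR.measurable_ham N).const_mul _).exp.ennreal_ofReal
  refine ⟨hf, Measure.ext fun s hs => ?_⟩
  rw [Measure.map_apply hf hs, posLaw, weight, withDensity_indicator hD, withDensity_apply _ hs,
    withDensity_apply _ (hf hs), ← (measurePreserving_flow hM N t).setLIntegral_comp_preimage hs hw,
    Measure.restrict_restrict (hf hs)]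
  refine setLIntegral_congr_fun ((hf hs).inter hD) fun x hx => ?_
  simp only [ham_flow hM hx.2]

variable (M) in
/-- Evenness of the insertion densities in the momenta. -/
def InsEven : Prop := ∀ N w x, M.ins N (reverse w) (reverse x) = M.ins N w x

theorem InsEven.barrierUp_reverse (hE : M.InsEven) (N : ℕ) (x : M.QP N) (w : M.New N) :
    M.barrierUp N (reverse x) (reverse w) = M.barrierUp N x w := by
  simp only [barrierUp, extend_reverse, ham_reverse, hE N w x]

theorem InsEven.barrierDown_reverse (hE : M.InsEven) (N : ℕ) (x : M.QP (N + 1)) :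
    M.barrierDown N (reverse x) = M.barrierDown N x := by
  simp only [barrierDown, truncate_reverse, removed_reverse, ham_reverse, hE N]

/-! ### Detailed balance of the crossings -/

variable (M) in
/-- The end point of `[N, N + 1]` towards which `n` moves. -/
def level (N : ℕ) (pn : ℝ) : ℝ := if 0 ≤ pn then ((N + 1 : ℕ) : ℝ) else (N : ℝ)

variable (M) in
/-- A state on the component `N` that is about to cross. -/
def crossingState (N : ℕ) (pn : ℝ) (x : M.QP N) : M.State := ⟨N, (x, (level N pn, pn))⟩

variable (M) in
/-- The measure on the states about to cross with respect to which crossings are reversible. -/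
def crossingLaw : Measure M.State :=
  Measure.sum fun N => (M.momLaw.prod (M.posLaw N)).map fun z => M.crossingState N z.1 z.2

theorem measurable_level (N : ℕ) : Measurable (level N) :=
  Measurable.ite measurableSet_Ici measurable_const measurable_const

theorem measurable_state {α : Type*} [MeasurableSpace α] (N : ℕ) {x : α → M.QP N} {n pn : α → ℝ}
    (hx : Measurable x) (hn : Measurable n) (hpn : Measurable pn) :
    Measurable fun a => (⟨N, (x a, (n a, pn a))⟩ : M.State) :=
  (measurable_sigmaMk (β := fun N => M.QP N × (ℝ × ℝ)) N).comp (hx.prodMk (hn.prodMk hpn))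

theorem measurable_crossingState (N : ℕ) :
    Measurable fun z : ℝ × M.QP N => M.crossingState N z.1 z.2 :=
  measurable_state N measurable_snd ((measurable_level N).comp measurable_fst) measurable_fst

theorem lintegral_crossingLaw {φ : M.State → ℝ≥0∞} (hφ : Measurable φ) :
    ∫⁻ s, φ s ∂M.crossingLaw =
      ∑' N, ∫⁻ pn, ∫⁻ x, φ (M.crossingState N pn x) ∂M.posLaw N ∂M.momLaw := by
  rw [crossingLaw, lintegral_sum_measure]
  refine tsum_congr fun N => ?_
  rw [lintegral_map hφ (measurable_crossingState N)]
  exact lintegral_prod _ (hφ.comp (measurable_crossingState N)).aemeasurable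

instance : SFinite M.crossingLaw := by unfold crossingLaw; infer_instance

variable (M) in
/-- The contribution of the accepted insertions. -/
def insAccepted (Ψ : M.State → M.State → ℝ≥0∞) (N : ℕ) (pn : ℝ) (x : M.QP N) (w : M.New N) :
    ℝ≥0∞ :=
  ENNReal.ofReal (M.ins N w x) * if M.barrierUp N x w ≤ pn then
    Ψ ⟨N, (x, (((N + 1 : ℕ) : ℝ), pn))⟩
      ⟨N + 1, (M.extend N x w, (((N + 1 : ℕ) : ℝ), pn - M.barrierUp N x w))⟩ else 0

variable (M) in
/-- The contribution of the rejected insertions. -/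
def insRejected (Ψ : M.State → M.State → ℝ≥0∞) (N : ℕ) (pn : ℝ) (x : M.QP N) (w : M.New N) :
    ℝ≥0∞ :=
  ENNReal.ofReal (M.ins N w x) * if M.barrierUp N x w ≤ pn then 0 else
    Ψ ⟨N, (x, (((N + 1 : ℕ) : ℝ), pn))⟩ ⟨N, (x, (((N + 1 : ℕ) : ℝ), -pn))⟩

variable (M) in
/-- Acceptance of a deletion. -/
def DelAccepts : (N : ℕ) → ℝ → M.QP N → Prop
  | 0, _, _ => False
  | N + 1, pn, x =>
    0 < M.ins N (M.removed N x) (M.truncate N x) ∧ M.barrierDown N x ≤ -pn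

open Classical in
variable (M) in
/-- The contribution of the accepted deletions. -/
def delAccepted (Ψ : M.State → M.State → ℝ≥0∞) (N : ℕ) (pn : ℝ) (x : M.QP (N + 1)) : ℝ≥0∞ :=
  if M.DelAccepts (N + 1) pn x then
    Ψ ⟨N + 1, (x, (((N + 1 : ℕ) : ℝ), pn))⟩
      ⟨N, (M.truncate N x, (((N + 1 : ℕ) : ℝ), pn + M.barrierDown N x))⟩ else 0

open Classical in
variable (M) in
/-- The contribution of the rejected deletions. -/
def delRejected (Ψ : M.State → M.State → ℝ≥0∞) (N : ℕ) (pn : ℝ) (x : M.QP N) : ℝ≥0∞ :=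
  if M.DelAccepts N pn x then 0 else Ψ ⟨N, (x, ((N : ℝ), pn))⟩ ⟨N, (x, ((N : ℝ), -pn))⟩

section Measurability

variable {Ψ : M.State → M.State → ℝ≥0∞}

theorem measurable_uncurry_comp (hΨ : Measurable (Function.uncurry Ψ)) {α : Type*}
    [MeasurableSpace α] {f g : α → M.State} (hf : Measurable f) (hg : Measurable g) :
    Measurable fun a => Ψ (f a) (g a) :=
  hΨ.comp (hf.prodMk hg)

theorem Regular.measurable_insAccepted (hR : M.Regular) (hΨ : Measurable (Function.uncurry Ψ))
    (N : ℕ) : Measurable fun z : ℝ × (M.QP N × M.New N) => M.insAccepted Ψ N z.1 z.2.1 z.2.2 := by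
  have hb : Measurable fun z : ℝ × (M.QP N × M.New N) => M.barrierUp N z.2.1 z.2.2 :=
    (hR.measurable_barrierUp N).comp measurable_snd
  have hx : Measurable fun z : ℝ × (M.QP N × M.New N) => z.2.1 := by fun_prop
  refine Measurable.mul ((measurable_ins_swap N).comp measurable_snd).ennreal_ofReal ?_
  refine Measurable.ite (measurableSet_le hb measurable_fst) ?_ measurable_const
  exact measurable_uncurry_comp hΨ (measurable_state N hx measurable_const measurable_fst)
    (measurable_state (N + 1) ((measurable_extend N).comp measurable_snd) measurable_const
      (measurable_fst.sub hb))

theorem Regular.measurable_insRejected (hR : M.Regular) (hΨ : Measurable (Function.uncurry Ψ))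
    (N : ℕ) : Measurable fun z : ℝ × (M.QP N × M.New N) => M.insRejected Ψ N z.1 z.2.1 z.2.2 := by
  have hb : Measurable fun z : ℝ × (M.QP N × M.New N) => M.barrierUp N z.2.1 z.2.2 :=
    (hR.measurable_barrierUp N).comp measurable_snd
  have hx : Measurable fun z : ℝ × (M.QP N × M.New N) => z.2.1 := by fun_prop
  refine Measurable.mul ((measurable_ins_swap N).comp measurable_snd).ennreal_ofReal ?_
  refine Measurable.ite (measurableSet_le hb measurable_fst) measurable_const ?_
  exact measurable_uncurry_comp hΨ (measurable_state N hx measurable_const measurable_fst)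
    (measurable_state N hx measurable_const measurable_fst.neg)

theorem Regular.measurableSet_delAccepts (hR : M.Regular) (N : ℕ) :
    MeasurableSet {z : ℝ × M.QP N | M.DelAccepts N z.1 z.2} := by
  cases N with
  | zero => exact MeasurableSet.empty
  | succ N =>
    have hi := (measurable_ins_swap N).comp
      ((measurable_truncate (M := M) N).prodMk (measurable_removed (M := M) N))
    exact (measurableSet_lt measurable_const (hi.comp measurable_snd)).inter
      (measurableSet_le ((hR.measurable_barrierDown N).comp measurable_snd) measurable_fst.neg)

theorem Regular.measurable_delAccepted (hR : M.Regular) (hΨ : Measurable (Function.uncurry Ψ))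
    (N : ℕ) : Measurable fun z : ℝ × M.QP (N + 1) => M.delAccepted Ψ N z.1 z.2 := by
  refine Measurable.ite (hR.measurableSet_delAccepts (N + 1)) ?_ measurable_const
  exact measurable_uncurry_comp hΨ (measurable_state (N + 1) measurable_snd measurable_const
    measurable_fst) (measurable_state N ((measurable_truncate N).comp measurable_snd)
      measurable_const (measurable_fst.add ((hR.measurable_barrierDown N).comp measurable_snd)))

theorem Regular.measurable_delRejected (hR : M.Regular) (hΨ : Measurable (Function.uncurry Ψ))
    (N : ℕ) : Measurable fun z : ℝ × M.QP N => M.delRejected Ψ N z.1 z.2 := by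
  refine Measurable.ite (hR.measurableSet_delAccepts N) measurable_const ?_
  exact measurable_uncurry_comp hΨ
    (measurable_state N measurable_snd measurable_const measurable_fst)
    (measurable_state N measurable_snd measurable_const measurable_fst.neg)

end Measurability

end Model

/-! ### Exchange of accepted insertions and deletions, invariance of rejections -/

namespace Model

variable {M : Model} {Ψ : M.State → M.State → ℝ≥0∞}

variable (M) in
/-- The total contribution of the accepted insertions at index `N`. -/
def insAcceptedMass (Ψ : M.State → M.State → ℝ≥0∞) (N : ℕ) : ℝ≥0∞ :=
  ∫⁻ pn in Ici 0, ∫⁻ x, (∫⁻ w, M.insAccepted Ψ N pn x w) ∂M.posLaw N ∂M.momLaw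

variable (M) in
/-- The total contribution of the rejected insertions at index `N`. -/
def insRejectedMass (Ψ : M.State → M.State → ℝ≥0∞) (N : ℕ) : ℝ≥0∞ :=
  ∫⁻ pn in Ici 0, ∫⁻ x, (∫⁻ w, M.insRejected Ψ N pn x w) ∂M.posLaw N ∂M.momLaw

variable (M) in
/-- The total contribution of the accepted deletions from index `N + 1`. -/
def delAcceptedMass (Ψ : M.State → M.State → ℝ≥0∞) (N : ℕ) : ℝ≥0∞ :=
  ∫⁻ pn in Iio 0, ∫⁻ x, M.delAccepted Ψ N pn x ∂M.posLaw (N + 1) ∂M.momLaw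

variable (M) in
/-- The total contribution of the rejected deletions at index `N`. -/
def delRejectedMass (Ψ : M.State → M.State → ℝ≥0∞) (N : ℕ) : ℝ≥0∞ :=
  ∫⁻ pn in Iio 0, ∫⁻ x, M.delRejected Ψ N pn x ∂M.posLaw N ∂M.momLaw

theorem crossingState_of_nonneg (N : ℕ) {pn : ℝ} (h : 0 ≤ pn) (x : M.QP N) :
    M.crossingState N pn x = ⟨N, (x, (((N + 1 : ℕ) : ℝ), pn))⟩ := by
  simp only [crossingState, level, if_pos h]

theorem crossingState_of_neg (N : ℕ) {pn : ℝ} (h : pn < 0) (x : M.QP N) :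
    M.crossingState N pn x = ⟨N, (x, ((N : ℝ), pn))⟩ := by
  simp only [crossingState, level, if_neg (not_le.2 h)]

theorem measurable_uncurry_right (hΨ : Measurable (Function.uncurry Ψ)) (s : M.State) :
    Measurable (Ψ s) := hΨ.comp measurable_prodMk_left

theorem Regular.lintegral_jump_of_nonneg (hR : M.Regular) (hmn : M.mn = 1)
    (hΨ : Measurable (Function.uncurry Ψ)) (N : ℕ) {pn : ℝ} (h : 0 ≤ pn) (x : M.QP N) :
    ∫⁻ s', Ψ (M.crossingState N pn x) s' ∂M.jump (M.crossingState N pn x) =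
      ∫⁻ w, (M.insAccepted Ψ N pn x w + M.insRejected Ψ N pn x w) := by
  rw [crossingState_of_nonneg N h, hR.lintegral_jump (measurable_uncurry_right hΨ _), if_pos h]
  refine lintegral_congr fun w => ?_
  simp only [insAccepted, insRejected, afterInsertion, kinN, hmn, div_one, abs_of_nonneg h, sgn,
    if_pos h, one_mul]
  split_ifs <;> simp

theorem Regular.lintegral_jump_of_neg_zero (hR : M.Regular)
    (hΨ : Measurable (Function.uncurry Ψ)) {pn : ℝ} (h : pn < 0) (x : M.QP 0) :
    ∫⁻ s', Ψ (M.crossingState 0 pn x) s' ∂M.jump (M.crossingState 0 pn x) =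
      M.delRejected Ψ 0 pn x := by
  rw [crossingState_of_neg 0 h, hR.lintegral_jump (measurable_uncurry_right hΨ _),
    if_neg (not_le.2 h)]
  rw [delRejected, if_neg (show ¬M.DelAccepts 0 pn x from id)]
  rfl

theorem Regular.lintegral_jump_of_neg_succ (hR : M.Regular) (hmn : M.mn = 1)
    (hΨ : Measurable (Function.uncurry Ψ)) (N : ℕ) {pn : ℝ} (h : pn < 0) (x : M.QP (N + 1)) :
    ∫⁻ s', Ψ (M.crossingState (N + 1) pn x) s' ∂M.jump (M.crossingState (N + 1) pn x) =
      M.delAccepted Ψ N pn x + M.delRejected Ψ (N + 1) pn x := by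
  rw [crossingState_of_neg (N + 1) h, hR.lintegral_jump (measurable_uncurry_right hΨ _),
    if_neg (not_le.2 h)]
  have hk : M.kinN pn = -pn := by rw [kinN, hmn, div_one, abs_of_neg h]
  by_cases hacc : M.DelAccepts (N + 1) pn x
  · rw [delAccepted, delRejected, if_pos hacc, if_pos hacc, add_zero, afterDeletion,
      if_pos ⟨hacc.1, hk ▸ hacc.2⟩, hmn, sgn, if_neg (not_le.2 h)]
    simp only [one_mul, neg_one_mul, sub_neg_eq_add]
  · rw [delAccepted, delRejected, if_neg hacc, if_neg hacc, zero_add, afterDeletion,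
      if_neg fun h' => hacc ⟨h'.1, hk ▸ h'.2⟩]

theorem Regular.lintegral_crossing (hR : M.Regular) (hmn : M.mn = 1)
    (hΨ : Measurable (Function.uncurry Ψ)) :
    ∫⁻ s, ∫⁻ s', Ψ s s' ∂M.jump s ∂M.crossingLaw =
      (∑' N, M.insAcceptedMass Ψ N + ∑' N, M.insRejectedMass Ψ N) +
        (∑' N, M.delAcceptedMass Ψ N + ∑' N, M.delRejectedMass Ψ N) := by
  have hins (N : ℕ) : ∫⁻ pn in Ici 0, ∫⁻ x, (∫⁻ s', Ψ (M.crossingState N pn x) s'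
      ∂M.jump (M.crossingState N pn x)) ∂M.posLaw N ∂M.momLaw =
        M.insAcceptedMass Ψ N + M.insRejectedMass Ψ N := by
    have hA := hR.measurable_insAccepted hΨ N
    have hA1 : Measurable fun z : ℝ × M.QP N => ∫⁻ w, M.insAccepted Ψ N z.1 z.2 w :=
      Measurable.lintegral_prod_right' (f := fun p : (ℝ × M.QP N) × M.New N =>
        M.insAccepted Ψ N p.1.1 p.1.2 p.2) (hA.comp (MeasurableEquiv.prodAssoc.measurable))
    have hA2 : Measurable fun pn : ℝ => ∫⁻ x, (∫⁻ w, M.insAccepted Ψ N pn x w) ∂M.posLaw N :=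
      hA1.lintegral_prod_right'
    rw [insAcceptedMass, insRejectedMass, ← lintegral_add_left hA2]
    refine setLIntegral_congr_fun measurableSet_Ici fun pn hpn => ?_
    have hA3 : Measurable fun x => ∫⁻ w, M.insAccepted Ψ N pn x w :=
      hA1.comp measurable_prodMk_left
    rw [← lintegral_add_left hA3]
    refine lintegral_congr fun x => ?_
    rw [hR.lintegral_jump_of_nonneg hmn hΨ N hpn]
    have hxw : Measurable fun w : M.New N => (pn, (x, w)) := by fun_prop
    exact lintegral_add_left (hA.comp hxw) _
  have hdel0 : ∫⁻ pn in Iio 0, ∫⁻ x, (∫⁻ s', Ψ (M.crossingState 0 pn x) s'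
      ∂M.jump (M.crossingState 0 pn x)) ∂M.posLaw 0 ∂M.momLaw = M.delRejectedMass Ψ 0 := by
    refine setLIntegral_congr_fun measurableSet_Iio fun pn hpn => ?_
    exact lintegral_congr fun x => hR.lintegral_jump_of_neg_zero hΨ hpn x
  have hdel (N : ℕ) : ∫⁻ pn in Iio 0, ∫⁻ x, (∫⁻ s', Ψ (M.crossingState (N + 1) pn x) s'
      ∂M.jump (M.crossingState (N + 1) pn x)) ∂M.posLaw (N + 1) ∂M.momLaw =
        M.delAcceptedMass Ψ N + M.delRejectedMass Ψ (N + 1) := by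
    have hA := hR.measurable_delAccepted hΨ N
    rw [delAcceptedMass, delRejectedMass, ← lintegral_add_left hA.lintegral_prod_right']
    refine setLIntegral_congr_fun measurableSet_Iio fun pn hpn => ?_
    have hA1 : Measurable fun x => M.delAccepted Ψ N pn x := hA.comp measurable_prodMk_left
    rw [← lintegral_add_left hA1]
    exact lintegral_congr fun x => hR.lintegral_jump_of_neg_succ hmn hΨ N hpn x
  have hm : Measurable fun s => ∫⁻ s', Ψ s s' ∂M.jump s :=
    hR.measurable_lintegral_jump_uncurry measurable_id hΨ
  -- Accepted deletions are indexed by the component they lead to, rejected ones by the component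
  -- they stay in. The term at index `0`, where every deletion is rejected, is split off to align
  -- the two sums.
  rw [lintegral_crossingLaw hm, ← ENNReal.tsum_add, tsum_eq_zero_add' (f := fun N => M.delRejectedMass Ψ N) ENNReal.summable,
    add_left_comm (∑' N, M.delAcceptedMass Ψ N), ← ENNReal.tsum_add]
  simp only [← hins, ← hdel, ← hdel0]
  rw [← tsum_eq_zero_add' (f := fun N => ∫⁻ pn in Iio 0, ∫⁻ x,
    (∫⁻ s', Ψ (M.crossingState N pn x) s' ∂M.jump (M.crossingState N pn x)) ∂M.posLaw N
      ∂M.momLaw) ENNReal.summable, ← ENNReal.tsum_add]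
  refine tsum_congr fun N => ?_
  rw [← lintegral_add_compl _ measurableSet_Ici (A := Ici (0 : ℝ)), compl_Ici]

variable (M) in
/-- Exchange the two end points of a transition and reverse them. -/
def skewSwap (Ψ : M.State → M.State → ℝ≥0∞) (s s' : M.State) : ℝ≥0∞ := Ψ (M.flip s') (M.flip s)

theorem skewSwap_skewSwap : M.skewSwap (M.skewSwap Ψ) = Ψ := by
  funext s s'
  simp only [skewSwap, flip_flip]

theorem measurable_skewSwap (hΨ : Measurable (Function.uncurry Ψ)) :
    Measurable (Function.uncurry (M.skewSwap Ψ)) :=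
  measurable_uncurry_comp hΨ (measurable_flip.comp measurable_snd)
    (measurable_flip.comp measurable_fst)

theorem flip_mk (N : ℕ) (x : M.QP N) (n pn : ℝ) :
    M.flip ⟨N, (x, (n, pn))⟩ = ⟨N, (reverse x, (n, -pn))⟩ := rfl

/-- A rejected pair differs only in the sign of `p_n`. Skew reversal therefore leaves `p_n` at both
ends as it was and merely replaces `p` by `-p`, which preserves the Gibbs weight and, by evenness,
the law of the proposal and its barrier. -/
theorem Regular.insRejectedMass_skewSwap (hR : M.Regular) (hE : M.InsEven)
    (hΨ : Measurable (Function.uncurry Ψ)) (N : ℕ) :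
    M.insRejectedMass (M.skewSwap Ψ) N = M.insRejectedMass Ψ N := by
  have hA := hR.measurable_insRejected hΨ N
  refine lintegral_congr fun pn => ?_
  have hA1 : Measurable fun x => ∫⁻ w, M.insRejected Ψ N pn x w :=
    Measurable.lintegral_prod_right' (f := fun p : M.QP N × M.New N =>
      M.insRejected Ψ N pn p.1 p.2) (hA.comp measurable_prodMk_left)
  rw [← (hR.measurePreserving_reverse_posLaw N).lintegral_comp hA1]
  refine lintegral_congr fun x => ?_
  have hxw : Measurable fun w : M.New N => (pn, (reverse x, w)) := by fun_prop
  have hA2 : Measurable fun w : M.New N => M.insRejected Ψ N pn (reverse x) w := hA.comp hxw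
  rw [← measurePreserving_reverse.lintegral_comp hA2]
  refine lintegral_congr fun w => ?_
  simp only [insRejected, hE N, hE.barrierUp_reverse, skewSwap, flip_mk, neg_neg]

theorem InsEven.delAccepts_reverse (hE : M.InsEven) (N : ℕ) (pn : ℝ) (x : M.QP N) :
    M.DelAccepts N pn (reverse x) ↔ M.DelAccepts N pn x := by
  cases N with
  | zero => exact Iff.rfl
  | succ N =>
    simp only [DelAccepts, truncate_reverse, removed_reverse, hE N, hE.barrierDown_reverse]

theorem Regular.delRejectedMass_skewSwap (hR : M.Regular) (hE : M.InsEven)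
    (hΨ : Measurable (Function.uncurry Ψ)) (N : ℕ) :
    M.delRejectedMass (M.skewSwap Ψ) N = M.delRejectedMass Ψ N := by
  refine lintegral_congr fun pn => ?_
  have hA : Measurable fun x => M.delRejected Ψ N pn x :=
    (hR.measurable_delRejected hΨ N).comp measurable_prodMk_left
  rw [← (hR.measurePreserving_reverse_posLaw N).lintegral_comp hA]
  refine lintegral_congr fun x => ?_
  have h := hE.delAccepts_reverse N pn x
  by_cases hacc : M.DelAccepts N pn x
  · rw [delRejected, delRejected, if_pos hacc, if_pos (h.2 hacc)]
  · rw [delRejected, delRejected, if_neg hacc, if_neg (mt h.1 hacc)]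
    simp only [skewSwap, flip_mk, neg_neg]

/-- Detailed balance between an insertion and the corresponding deletion, for fixed coordinates. -/
theorem Regular.setLIntegral_deletion_eq (hR : M.Regular) (hΨ : Measurable (Function.uncurry Ψ))
    (hmn : M.mn = 1) (N : ℕ) (x : M.QP N) (w : M.New N) :
    M.weight (N + 1) (M.extend N x w) * ∫⁻ u in Ioi 0,
        (if 0 < M.ins N w x ∧ -M.barrierUp N x w ≤ u then
          Ψ ⟨N, (x, (((N + 1 : ℕ) : ℝ), u + M.barrierUp N x w))⟩
            ⟨N + 1, (M.extend N x w, (((N + 1 : ℕ) : ℝ), u))⟩ else 0) ∂M.momLaw =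
      M.weight N x * ∫⁻ v in Ici 0, M.insAccepted Ψ N v x w ∂M.momLaw := by
  set δ := M.barrierUp N x w with hδ
  set D : ℝ → ℝ≥0∞ := fun u => if 0 < M.ins N w x ∧ -δ ≤ u then
    Ψ ⟨N, (x, (((N + 1 : ℕ) : ℝ), u + δ))⟩ ⟨N + 1, (M.extend N x w, (((N + 1 : ℕ) : ℝ), u))⟩ else 0
    with hD
  -- Where the insertion density vanishes, the deletion is rejected and the insertion has no mass. A
  -- positive density places both end points in their domains.
  rcases (M.ins_nonneg N w x).eq_or_lt with h0 | h0
  · simp [insAccepted, D, ← h0]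
  have hx : x ∈ M.domain N := by
    by_contra hx
    exact h0.ne' (hR.ins_eq_zero N w x hx)
  have hy : M.extend N x w ∈ M.domain (N + 1) := by
    by_contra hy
    exact h0.ne' (M.ins_support N w x hx hy)
  have hDm : Measurable D := by
    refine Measurable.ite ((MeasurableSet.const _).inter measurableSet_Ici) ?_ measurable_const
    exact measurable_uncurry_comp hΨ (measurable_state N measurable_const measurable_const
      (measurable_id.add_const δ)) (measurable_state (N + 1) measurable_const measurable_const
        measurable_id)
  have hv : Measurable fun v : ℝ => (v, (x, w)) := by fun_prop
  have hIm : Measurable fun v => M.insAccepted Ψ N v x w := (hR.measurable_insAccepted hΨ N).comp hv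
  have ha : Measurable ((Ioi 0).indicator fun u : ℝ =>
      ENNReal.ofReal (Real.exp (-M.β * M.kinN u)) * D u) :=
    (measurable_momWeight.mul hDm).indicator measurableSet_Ioi
  have hb : Measurable ((Ici 0).indicator fun v : ℝ =>
      ENNReal.ofReal (Real.exp (-M.β * M.kinN v)) * M.insAccepted Ψ N v x w) :=
    (measurable_momWeight.mul hIm).indicator measurableSet_Ici
  have hb' : Measurable fun u => (Ici 0).indicator (fun v : ℝ =>
      ENNReal.ofReal (Real.exp (-M.β * M.kinN v)) * M.insAccepted Ψ N v x w) (u + δ) :=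
    hb.comp (measurable_add_const δ)
  -- Both integrals become Lebesgue integrals over the line, compared through the translation `v = u
  -- + δ`.
  rw [setLIntegral_momLaw hDm measurableSet_Ioi, setLIntegral_momLaw hIm measurableSet_Ici,
    ← lintegral_indicator measurableSet_Ioi, ← lintegral_indicator measurableSet_Ici,
    ← lintegral_add_right_eq_self ((Ici 0).indicator fun v : ℝ =>
      ENNReal.ofReal (Real.exp (-M.β * M.kinN v)) * M.insAccepted Ψ N v x w) δ,
    ← lintegral_const_mul _ ha, ← lintegral_const_mul _ hb']
  refine lintegral_congr_ae ?_
  -- At `u = 0` an insertion uses up the whole momentum; the deletion integral over `u > 0` omits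
  -- this null set.
  filter_upwards [Measure.ae_ne volume (0 : ℝ)] with u hu
  rcases lt_or_gt_of_ne hu with hu | hu
  · have h1 : u ∉ Ioi (0 : ℝ) := not_lt.2 hu.le
    have h2 : ¬ δ ≤ u + δ := by linarith
    rw [indicator_of_notMem h1]
    by_cases h3 : u + δ ∈ Ici (0 : ℝ)
    · rw [indicator_of_mem h3, insAccepted, if_neg h2]
      simp
    · rw [indicator_of_notMem h3, mul_zero, mul_zero]
  rw [indicator_of_mem (show u ∈ Ioi (0 : ℝ) from hu)]
  by_cases h3 : 0 ≤ u + δ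
  · have h4 : δ ≤ u + δ := by linarith
    have h5 : -δ ≤ u := by linarith
    rw [indicator_of_mem (show u + δ ∈ Ici (0 : ℝ) from h3), insAccepted, if_pos h4, ← hδ,
      add_sub_cancel_right]
    simp only [D]
    rw [if_pos ⟨h0, h5⟩, ← mul_assoc, ← mul_assoc, ← mul_assoc]
    congr 1
    rw [weight, weight, indicator_of_mem hx, indicator_of_mem hy,
      ← ENNReal.ofReal_mul (Real.exp_nonneg _), ← ENNReal.ofReal_mul (Real.exp_nonneg _),
      ← ENNReal.ofReal_mul (by positivity), kinN, kinN, hmn, div_one, div_one, abs_of_pos hu,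
      abs_of_nonneg h3]
    congr 1
    -- Writing the density as `e^{log π}` reduces the equality of weights to one of exponents:
    -- `H_{N+1} + u = H_N - β⁻¹ log π + (u + δ)`.
    rw [← Real.exp_log h0]
    rw [← Real.exp_add, ← Real.exp_add, ← Real.exp_add]
    congr 1
    have := M.β_pos
    rw [hδ, barrierUp]
    field_simp
    ring
  · have h5 : ¬ -δ ≤ u := by linarith
    rw [indicator_of_notMem (show u + δ ∉ Ici (0 : ℝ) from h3)]
    simp [D, h5]

/-- After reversal of all momenta, the pair on component `N + 1` is written as an extension of `(x,
w)`, which preserves volume. The two masses are then compared for fixed `x` and `w` by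
`Regular.setLIntegral_deletion_eq`. -/
theorem Regular.delAcceptedMass_skewSwap (hR : M.Regular) (hE : M.InsEven) (hmn : M.mn = 1)
    (hΨ : Measurable (Function.uncurry Ψ)) (N : ℕ) :
    M.delAcceptedMass (M.skewSwap Ψ) N = M.insAcceptedMass Ψ N := by
  set L : ℝ := ((N + 1 : ℕ) : ℝ) with hL
  set D : ℝ → M.QP (N + 1) → ℝ≥0∞ := fun u y =>
    if 0 < M.ins N (M.removed N y) (M.truncate N y) ∧ M.barrierDown N y ≤ u then
      Ψ ⟨N, (M.truncate N y, (L, u - M.barrierDown N y))⟩ ⟨N + 1, (y, (L, u))⟩ else 0 with hD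
  have hDm : Measurable (Function.uncurry D) := by
    have hi := (measurable_ins_swap N).comp
      ((measurable_truncate (M := M) N).prodMk (measurable_removed (M := M) N))
    have hb : Measurable fun z : ℝ × M.QP (N + 1) => M.barrierDown N z.2 :=
      (hR.measurable_barrierDown N).comp measurable_snd
    refine Measurable.ite ((measurableSet_lt measurable_const (hi.comp measurable_snd)).inter
      (measurableSet_le hb measurable_fst)) ?_ measurable_const
    exact measurable_uncurry_comp hΨ (measurable_state N
      ((measurable_truncate N).comp measurable_snd) measurable_const (measurable_fst.sub hb))
      (measurable_state (N + 1) measurable_snd measurable_const measurable_fst)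
  have hDm' (u : ℝ) : Measurable (D u) := hDm.comp measurable_prodMk_left
  have hskew (pn : ℝ) (y : M.QP (N + 1)) :
      M.delAccepted (M.skewSwap Ψ) N pn y = D (-pn) (reverse y) := by
    have h : (0 < M.ins N (M.removed N (reverse y)) (M.truncate N (reverse y)) ∧
        M.barrierDown N (reverse y) ≤ -pn) ↔ M.DelAccepts (N + 1) pn y :=
      hE.delAccepts_reverse (N + 1) pn y
    by_cases hacc : M.DelAccepts (N + 1) pn y
    · simp only [D]
      rw [delAccepted, if_pos hacc, if_pos (h.2 hacc), skewSwap, flip_mk, flip_mk,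
        truncate_reverse, hE.barrierDown_reverse, neg_add']
    · simp only [D]
      rw [delAccepted, if_neg hacc, if_neg (mt h.1 hacc)]
  have hA := hR.measurable_insAccepted hΨ N
  have hA1 : Measurable fun z : ℝ × M.QP N => ∫⁻ w, M.insAccepted Ψ N z.1 z.2 w :=
    Measurable.lintegral_prod_right' (f := fun p : (ℝ × M.QP N) × M.New N =>
      M.insAccepted Ψ N p.1.1 p.1.2 p.2) (hA.comp (MeasurableEquiv.prodAssoc.measurable))
  have hA2 (x : M.QP N) : Measurable fun z : ℝ × M.New N => M.insAccepted Ψ N z.1 x z.2 := by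
    have h : Measurable fun z : ℝ × M.New N => (z.1, (x, z.2)) := by fun_prop
    exact hA.comp h
  have hDI : Measurable fun y => ∫⁻ u in Ioi 0, D u y ∂M.momLaw := hDm.lintegral_prod_left'
  have hWm : Measurable fun y => M.weight (N + 1) y * ∫⁻ u in Ioi 0, D u y ∂M.momLaw :=
    (hR.measurable_weight (N + 1)).mul hDI
  have hl : M.delAcceptedMass (M.skewSwap Ψ) N = ∫⁻ x, ∫⁻ w, M.weight (N + 1) (M.extend N x w) *
      ∫⁻ u in Ioi 0, D u (M.extend N x w) ∂M.momLaw := by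
    have h1 : M.delAcceptedMass (M.skewSwap Ψ) N =
        ∫⁻ pn in Neg.neg ⁻¹' Ioi (0 : ℝ), ∫⁻ y, D (-pn) y ∂M.posLaw (N + 1) ∂M.momLaw := by
      rw [delAcceptedMass, show Neg.neg ⁻¹' Ioi (0 : ℝ) = Iio 0 by ext; simp]
      refine lintegral_congr fun pn => ?_
      rw [← (hR.measurePreserving_reverse_posLaw (N + 1)).lintegral_comp (hDm' (-pn))]
      exact lintegral_congr fun y => hskew pn y
    rw [h1, measurePreserving_neg_momLaw.setLIntegral_comp_preimage measurableSet_Ioi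
      (f := fun u => ∫⁻ y, D u y ∂M.posLaw (N + 1)) hDm.lintegral_prod_right',
      lintegral_lintegral_swap hDm.aemeasurable, hR.lintegral_posLaw _ hDI,
      ← (measurePreserving_extend N).lintegral_comp hWm]
    exact lintegral_prod _ (hWm.comp (measurable_extend N)).aemeasurable
  have hr : M.insAcceptedMass Ψ N = ∫⁻ x, ∫⁻ w, M.weight N x *
      ∫⁻ v in Ici 0, M.insAccepted Ψ N v x w ∂M.momLaw := by
    rw [insAcceptedMass, lintegral_lintegral_swap hA1.aemeasurable,
      hR.lintegral_posLaw _ hA1.lintegral_prod_left']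
    refine lintegral_congr fun x => ?_
    rw [lintegral_const_mul _ (hA2 x).lintegral_prod_left',
      lintegral_lintegral_swap (hA2 x).aemeasurable]
  rw [hl, hr]
  refine lintegral_congr fun x => lintegral_congr fun w => ?_
  rw [← hR.setLIntegral_deletion_eq hΨ hmn N x w]
  simp only [D, truncate_extend, removed_extend, barrierDown_extend, sub_neg_eq_add, hL]

/-- Skew detailed balance of the crossings. -/
theorem Regular.crossing_skew_balance (hR : M.Regular) (hE : M.InsEven) (hmn : M.mn = 1)
    (hΨ : Measurable (Function.uncurry Ψ)) :
    ∫⁻ s, ∫⁻ s', Ψ s s' ∂M.jump s ∂M.crossingLaw =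
      ∫⁻ s, ∫⁻ s', Ψ (M.flip s') (M.flip s) ∂M.jump s ∂M.crossingLaw := by
  have hΨ' := measurable_skewSwap hΨ
  have h : M.insAcceptedMass (M.skewSwap Ψ) = M.delAcceptedMass Ψ := by
    funext N
    rw [← hR.delAcceptedMass_skewSwap hE hmn hΨ' N, skewSwap_skewSwap]
  rw [hR.lintegral_crossing hmn hΨ]
  refine Eq.trans ?_ (hR.lintegral_crossing hmn hΨ').symm
  simp only [h, hR.delAcceptedMass_skewSwap hE hmn hΨ, hR.insRejectedMass_skewSwap hE hΨ,
    hR.delRejectedMass_skewSwap hE hΨ]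
  ring

end Model

/-! ### The target as a product of Gibbs measures and Lebesgue measure in `n` -/

namespace Model

variable {M : Model} {f g : M.State → ℝ≥0∞}

/-- The logarithmic term of `ham` accounts exactly for the Gaussian normalization, so that the
remaining constant of the target is the same on all components. -/
theorem mul_exp_kin (N : ℕ) (x : M.QP N) :
    Real.exp (-M.β * M.U N x.1) * ((M.Zp N)⁻¹ * Real.exp (-M.β * M.kin x.2)) =
      Real.exp (-M.β * M.ham N x) := by
  have hβ := M.β_pos
  have hm := M.m_pos
  have h0 : 0 < 2 * M.m * Real.pi / M.β := by positivity
  rw [Zp, Real.rpow_def_of_pos h0, ← Real.exp_neg, ← Real.exp_add, ← Real.exp_add, ham]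
  congr 1
  field_simp
  ring

theorem density_eq (N : ℕ) (z : M.QP N × (ℝ × ℝ)) :
    M.density N z = (M.Zβ⁻¹ * M.Zn⁻¹) * (Real.exp (-M.β * M.kinN z.2.2) *
      Real.exp (-M.β * M.ham N z.1)) := by
  rw [density, ← mul_exp_kin]
  ring

theorem lintegral_momLaw {φ : ℝ → ℝ≥0∞} (hφ : Measurable φ) :
    ∫⁻ pn, φ pn ∂M.momLaw = ∫⁻ pn, ENNReal.ofReal (Real.exp (-M.β * M.kinN pn)) * φ pn :=
  lintegral_withDensity_eq_lintegral_mul _ measurable_momWeight hφ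

theorem Regular.lintegral_target (hR : M.Regular) {φ : M.State → ℝ≥0∞} (hφ : Measurable φ) :
    ∫⁻ s, φ s ∂M.target = ENNReal.ofReal (M.Zβ⁻¹ * M.Zn⁻¹) *
      ∑' N : ℕ, ∫⁻ pn, (∫⁻ n in Ico (N : ℝ) (N + 1),
        (∫⁻ x, φ ⟨N, (x, (n, pn))⟩ ∂M.posLaw N)) ∂M.momLaw := by
  rw [target, lintegral_sum_measure, ← ENNReal.tsum_mul_left]
  refine tsum_congr fun N => ?_
  have hmk : Measurable fun z : M.QP N × (ℝ × ℝ) => (⟨N, z⟩ : M.State) :=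
    measurable_sigmaMk (β := fun N => M.QP N × (ℝ × ℝ)) N
  have hd : Measurable fun z : M.QP N × (ℝ × ℝ) => ENNReal.ofReal (M.density N z) := by
    simp only [density_eq]
    have h1 : Measurable fun z : M.QP N × (ℝ × ℝ) => M.kinN z.2.2 :=
      measurable_kinN.comp (by fun_prop)
    have h2 : Measurable fun z : M.QP N × (ℝ × ℝ) => M.ham N z.1 :=
      (hR.measurable_ham N).comp measurable_fst
    fun_prop
  have hS : MeasurableSet {z : M.QP N × (ℝ × ℝ) | z.1.1 ∈ M.V N ∧ z.2.1 ∈ Ico (N : ℝ) (N + 1)} :=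
    ((measurableSet_domain N).preimage measurable_fst).inter
      (measurableSet_Ico.preimage measurable_snd.fst)
  have hC : 0 ≤ M.Zβ⁻¹ * M.Zn⁻¹ := by
    have := M.β_pos
    have := M.mn_pos
    have : 0 ≤ M.Zβ := ENNReal.toReal_nonneg
    unfold Zn
    positivity
  have hφ3 : Measurable fun z : M.QP N × (ℝ × ℝ) => φ ⟨N, z⟩ := hφ.comp hmk
  have hφx (n pn : ℝ) : Measurable fun x => φ ⟨N, (x, (n, pn))⟩ :=
    hφ3.comp measurable_prodMk_right
  have hφ2 : Measurable fun y : ℝ × ℝ => ∫⁻ x, φ ⟨N, (x, y)⟩ ∂M.posLaw N :=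
    hφ3.lintegral_prod_left'
  have hφ1 : Measurable fun pn : ℝ => ∫⁻ n in Ico (N : ℝ) (N + 1),
      (∫⁻ x, φ ⟨N, (x, (n, pn))⟩ ∂M.posLaw N) := hφ2.lintegral_prod_left'
  have hw := hR.measurable_weight N
  have hmw := M.measurable_momWeight
  set c := ENNReal.ofReal (M.Zβ⁻¹ * M.Zn⁻¹)
  set G : M.QP N × (ℝ × ℝ) → ℝ≥0∞ := fun z =>
    c * (ENNReal.ofReal (Real.exp (-M.β * M.kinN z.2.2)) *
      (Ico (N : ℝ) (N + 1)).indicator (fun _ => M.weight N z.1 * φ ⟨N, z⟩) z.2.1) with hG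
  have hGm : Measurable G := by
    refine Measurable.const_mul (Measurable.mul (hmw.comp (by fun_prop)) ?_) _
    exact Measurable.ite (measurableSet_Ico.preimage measurable_snd.fst)
      ((hw.comp measurable_fst).mul hφ3) measurable_const
  have e1 : ∫⁻ s, φ s ∂(((volume.restrict
        {z : M.QP N × (ℝ × ℝ) | z.1.1 ∈ M.V N ∧ z.2.1 ∈ Ico (N : ℝ) (N + 1)}).withDensity
      fun z => ENNReal.ofReal (M.density N z)).map (Sigma.mk N)) = ∫⁻ z, G z := by
    rw [lintegral_map hφ hmk, lintegral_withDensity_eq_lintegral_mul _ hd hφ3,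
      ← lintegral_indicator hS]
    refine lintegral_congr fun z => ?_
    by_cases hx : z.1 ∈ M.domain N
    · by_cases hn : z.2.1 ∈ Ico (N : ℝ) (N + 1)
      · rw [indicator_of_mem (show z ∈ {z : M.QP N × (ℝ × ℝ) | z.1.1 ∈ M.V N ∧
          z.2.1 ∈ Ico (N : ℝ) (N + 1)} from ⟨hx, hn⟩), Pi.mul_apply,
          density_eq, ENNReal.ofReal_mul hC, ENNReal.ofReal_mul (Real.exp_nonneg _)]
        simp only [G]
        rw [indicator_of_mem hn, weight, indicator_of_mem hx, mul_assoc, mul_assoc]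
      · rw [indicator_of_notMem fun h => hn h.2]
        simp only [G]
        rw [indicator_of_notMem hn, mul_zero, mul_zero]
    · rw [indicator_of_notMem fun h => hx h.1]
      simp only [G]
      rw [weight, indicator_of_notMem hx, zero_mul]
      simp
  rw [e1, Measure.volume_eq_prod, lintegral_prod_symm _ hGm.aemeasurable, Measure.volume_eq_prod,
    lintegral_prod_symm _ hGm.lintegral_prod_left'.aemeasurable, lintegral_momLaw hφ1,
    ← lintegral_const_mul _ (hmw.fun_mul hφ1)]
  refine lintegral_congr fun pn => ?_
  have hφ0 : Measurable fun n : ℝ => ∫⁻ x, φ ⟨N, (x, (n, pn))⟩ ∂M.posLaw N :=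
    hφ2.comp measurable_prodMk_right
  rw [← lintegral_indicator measurableSet_Ico, ← lintegral_const_mul _
    (hφ0.indicator measurableSet_Ico), ← lintegral_const_mul _
    ((hφ0.indicator measurableSet_Ico).const_mul _)]
  refine lintegral_congr fun n => ?_
  simp only [G]
  by_cases hn : n ∈ Ico (N : ℝ) (N + 1)
  · simp only [indicator_of_mem hn]
    rw [hR.lintegral_posLaw N (hφx n pn), ← lintegral_const_mul _ (hw.fun_mul (hφx n pn)),
      ← lintegral_const_mul _ ((hw.fun_mul (hφx n pn)).const_mul _)]
  · simp only [indicator_of_notMem hn, mul_zero, lintegral_zero]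

/-! ### Transitions without crossing -/

theorem freeMove_mk (hmn : M.mn = 1) (t : ℝ) (N : ℕ) (x : M.QP N) (n pn : ℝ) :
    M.freeMove t ⟨N, (x, (n, pn))⟩ = ⟨N, (M.flow N t x, (n + t * sgn pn, pn))⟩ := by
  simp only [freeMove, hmn, div_one]

theorem sgn_neg {r : ℝ} (h : r ≠ 0) : sgn (-r) = -sgn r := by
  rcases lt_or_gt_of_ne h with h | h
  · simp [sgn, h.le, not_le.2 h]
  · simp [sgn, h.le, not_le.2 h]

/-- The value `p_n = 0` is excluded because `sgn 0 = 1`: there the change of sign does not reverse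
the motion of `n`. -/
theorem freeMove_flip (hM : M.Complete) (hmn : M.mn = 1) (t : ℝ) {s : M.State}
    (hs : s.2.2.2 ≠ 0) : M.freeMove t (M.flip s) = M.flip (M.freeMove (-t) s) := by
  obtain ⟨N, x, n, pn⟩ := s
  rw [flip_mk, freeMove_mk hmn, freeMove_mk hmn, flip_mk, sgn_neg hs]
  have h : M.flow N t (reverse x) = reverse (M.flow N (-t) x) := flow_reverse hM N t x
  rw [h]
  simp

variable (M) in
/-- The time at which `n` reaches an end point of `[N, N + 1]`, for unit speed. -/
def exitTime (N : ℕ) (n pn : ℝ) : ℝ := if 0 ≤ pn then N + 1 - n else n - N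

theorem hitTime_mk (hmn : M.mn = 1) (N : ℕ) (x : M.QP N) (n pn : ℝ) :
    M.hitTime ⟨N, (x, (n, pn))⟩ = exitTime N n pn := by
  simp only [hitTime, exitTime, hmn, one_mul]

variable (M) in
/-- The contribution of the transitions without crossing that start at `(n, p_n)`. -/
def freeMass (f g : M.State → ℝ≥0∞) (T : ℝ) (N : ℕ) (pn n : ℝ) : ℝ≥0∞ :=
  ∫⁻ x, f ⟨N, (x, (n, pn))⟩ * g (M.freeMove T ⟨N, (x, (n, pn))⟩) ∂M.posLaw N

/-- The substitution `x ↦ reverse (flow T x)` preserves the Gibbs measure and sends the start of a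
path to the start of the reversed path. -/
theorem Regular.freeMass_flip (hR : M.Regular) (hM : M.Complete) (hmn : M.mn = 1)
    (hf : Measurable f) (hg : Measurable g) (T : ℝ) (N : ℕ) {pn : ℝ} (hpn : 0 < pn) (n : ℝ) :
    M.freeMass (g ∘ M.flip) (f ∘ M.flip) T N (-pn) n = M.freeMass f g T N pn (n - T) := by
  have hpn' : ¬0 ≤ -pn := by linarith
  have hrev := hR.measurePreserving_reverse_posLaw N
  have hflow := hR.measurePreserving_flow_posLaw hM N T
  have hm : Measurable fun x => (g ∘ M.flip) ⟨N, (x, (n, -pn))⟩ *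
      (f ∘ M.flip) (M.freeMove T ⟨N, (x, (n, -pn))⟩) := by
    have h : Measurable fun x : M.QP N => (⟨N, (x, (n, -pn))⟩ : M.State) :=
      measurable_state N measurable_id measurable_const measurable_const
    exact ((hg.comp measurable_flip).comp h).mul
      ((hf.comp measurable_flip).comp ((measurable_freeMove_const hM T).comp h))
  rw [freeMass, freeMass, ← (hrev.comp hflow).lintegral_comp hm]
  refine lintegral_congr fun x => ?_
  have h1 : M.flow N T (reverse (M.flow N T x)) = reverse x := by
    have h : M.flow N T (reverse (M.flow N T x)) = reverse (M.flow N (-T) (M.flow N T x)) :=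
      flow_reverse hM N T _
    rw [h, flow_flow hM, add_neg_cancel, flow_zero hM]
  simp only [Function.comp_apply, freeMove_mk hmn, flip_mk, h1, reverse_reverse, neg_neg, sgn,
    if_pos hpn.le, if_neg hpn', mul_one, mul_neg, sub_add_cancel, ← sub_eq_add_neg]
  rw [mul_comm]

variable (M) in
/-- The contribution of the transitions without crossing at momentum `p_n`. -/
def freeMassAt (f g : M.State → ℝ≥0∞) (T : ℝ) (N : ℕ) (pn : ℝ) : ℝ≥0∞ :=
  ∫⁻ n in Ico (N : ℝ) (N + 1), if exitTime N n pn ≤ T then 0 else M.freeMass f g T N pn n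

theorem Regular.freeMassAt_flip_of_pos (hR : M.Regular) (hM : M.Complete) (hmn : M.mn = 1)
    (hf : Measurable f) (hg : Measurable g) {T : ℝ} (hT : 0 ≤ T) (N : ℕ) {pn : ℝ} (hpn : 0 < pn) :
    M.freeMassAt (g ∘ M.flip) (f ∘ M.flip) T N (-pn) = M.freeMassAt f g T N pn := by
  have hpn' : ¬0 ≤ -pn := by linarith
  rw [freeMassAt, freeMassAt, ← lintegral_indicator measurableSet_Ico,
    ← lintegral_indicator measurableSet_Ico, ← lintegral_add_right_eq_self _ T]
  refine lintegral_congr_ae ?_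
  -- A path from `n = N` may be free of crossings while its reversal hits `N` exactly at time `T`,
  -- which counts as a crossing.
  filter_upwards [Measure.ae_ne volume (N : ℝ)] with n hn
  simp only [hR.freeMass_flip hM hmn hf hg T N hpn, add_sub_cancel_right, indicator, mem_Ico,
    exitTime, if_pos hpn.le, if_neg hpn']
  have hiff : ((N : ℝ) ≤ n + T ∧ n + T < N + 1) ∧ ¬n + T - N ≤ T ↔
      ((N : ℝ) ≤ n ∧ n < N + 1) ∧ ¬(N : ℝ) + 1 - n ≤ T := by
    constructor
    · rintro ⟨⟨h1, h2⟩, h3⟩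
      exact ⟨⟨by linarith, by linarith⟩, by linarith⟩
    · rintro ⟨⟨h1, h2⟩, h3⟩
      have : (N : ℝ) < n := lt_of_le_of_ne h1 (Ne.symm hn)
      exact ⟨⟨by linarith, by linarith⟩, by linarith⟩
  by_cases h : ((N : ℝ) ≤ n ∧ n < N + 1) ∧ ¬(N : ℝ) + 1 - n ≤ T
  · have h' := hiff.2 h
    rw [if_pos h.1, if_pos h'.1, if_neg h.2, if_neg h'.2]
  · have h' := mt hiff.1 h
    have aux : ∀ {p q : Prop} [Decidable p] [Decidable q] (a : ℝ≥0∞), ¬(p ∧ ¬q) →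
        (if p then (if q then 0 else a) else 0) = 0 := by
      intro p q _ _ a h
      split_ifs <;> tauto
    rw [aux _ h, aux _ h']

theorem comp_flip_comp_flip (f : M.State → ℝ≥0∞) : (f ∘ M.flip) ∘ M.flip = f := by
  funext s
  simp only [Function.comp_apply, flip_flip]

theorem ae_momLaw_ne_zero : ∀ᵐ pn ∂M.momLaw, pn ≠ 0 :=
  (withDensity_absolutelyContinuous volume _).ae_le (Measure.ae_ne volume (0 : ℝ))

theorem Regular.lintegral_freeMassAt (hR : M.Regular) (hM : M.Complete) (hmn : M.mn = 1)
    (hf : Measurable f) (hg : Measurable g) {T : ℝ} (hT : 0 ≤ T) (N : ℕ) :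
    ∫⁻ pn, M.freeMassAt f g T N pn ∂M.momLaw =
      ∫⁻ pn, M.freeMassAt (g ∘ M.flip) (f ∘ M.flip) T N pn ∂M.momLaw := by
  rw [← (measurePreserving_neg_momLaw (M := M)).lintegral_comp_emb
    (MeasurableEquiv.neg ℝ).measurableEmbedding (M.freeMassAt (g ∘ M.flip) (f ∘ M.flip) T N)]
  refine lintegral_congr_ae ?_
  filter_upwards [ae_momLaw_ne_zero] with pn hpn
  rcases lt_or_gt_of_ne hpn with h | h
  -- Negative `p_n` reduces to the positive case by exchanging the roles of a path and its reversal.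
  · have := hR.freeMassAt_flip_of_pos hM hmn (hg.comp measurable_flip) (hf.comp measurable_flip)
      hT N (neg_pos.2 h)
    rwa [comp_flip_comp_flip, comp_flip_comp_flip, neg_neg] at this
  · exact (hR.freeMassAt_flip_of_pos hM hmn hf hg hT N h).symm

end Model

namespace Model

variable {M : Model} {f g : M.State → ℝ≥0∞}

/-! ### Transitions with a crossing -/

theorem level_eq (N : ℕ) (n pn : ℝ) : n + exitTime N n pn * sgn pn = level N pn := by
  simp only [exitTime, sgn, level]
  split_ifs
  · push_cast; ring
  · ring

theorem freeMove_exitTime (hmn : M.mn = 1) (N : ℕ) (x : M.QP N) (n pn : ℝ) :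
    M.freeMove (exitTime N n pn) ⟨N, (x, (n, pn))⟩ =
      M.crossingState N pn (M.flow N (exitTime N n pn) x) := by
  rw [freeMove_mk hmn, level_eq, crossingState]

theorem freeMove_neg_exitTime (hmn : M.mn = 1) (N : ℕ) (x : M.QP N) (n pn : ℝ) :
    M.freeMove (-exitTime N n pn) (M.crossingState N pn x) =
      ⟨N, (M.flow N (-exitTime N n pn) x, (n, pn))⟩ := by
  rw [crossingState, freeMove_mk hmn, ← level_eq N n pn, neg_mul, add_neg_cancel_right]

variable (M) in
/-- The contribution of the transitions through the crossing state `s`, which is met at time `h`. -/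
def crossingMass (f g : M.State → ℝ≥0∞) (T : ℝ) (h : ℝ) (s : M.State) : ℝ≥0∞ :=
  f (M.freeMove (-h) s) * ∫⁻ s', g (M.freeMove (T - h) s') ∂M.jump s

theorem Regular.measurable_crossingMass (hR : M.Regular) (hM : M.Complete) (hf : Measurable f)
    (hg : Measurable g) (T : ℝ) :
    Measurable fun z : ℝ × M.State => M.crossingMass f g T z.1 z.2 := by
  have h1 : Measurable fun z : ℝ × M.State => M.freeMove (-z.1) z.2 :=
    (measurable_freeMove hM).comp (measurable_fst.neg.prodMk measurable_snd)
  have h2 : Measurable fun z : (ℝ × M.State) × M.State => M.freeMove (T - z.1.1) z.2 :=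
    (measurable_freeMove hM).comp ((measurable_const.sub measurable_fst.fst).prodMk measurable_snd)
  exact (hf.comp h1).mul (hR.measurable_lintegral_jump_uncurry measurable_snd
    (φ := fun z s' => g (M.freeMove (T - z.1) s')) (hg.comp h2))

/-- Invariance under the flow changes the integration variable from the starting point to the state
that is met at the crossing. -/
theorem Regular.lintegral_crossing_start (hR : M.Regular) (hM : M.Complete) (hmn : M.mn = 1)
    (hf : Measurable f) (hg : Measurable g) (T : ℝ) (N : ℕ) (n pn : ℝ) :
    ∫⁻ x, f ⟨N, (x, (n, pn))⟩ * (∫⁻ s', g (M.freeMove (T - exitTime N n pn) s')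
        ∂M.jump (M.freeMove (exitTime N n pn) ⟨N, (x, (n, pn))⟩)) ∂M.posLaw N =
      ∫⁻ x, M.crossingMass f g T (exitTime N n pn) (M.crossingState N pn x) ∂M.posLaw N := by
  have hm : Measurable fun x =>
      M.crossingMass f g T (exitTime N n pn) (M.crossingState N pn x) := by
    have h : Measurable fun x => (exitTime N n pn, M.crossingState N pn x) :=
      measurable_const.prodMk ((measurable_crossingState N).comp measurable_prodMk_left)
    exact (hR.measurable_crossingMass hM hf hg T).comp h
  rw [← (hR.measurePreserving_flow_posLaw hM N (exitTime N n pn)).lintegral_comp hm]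
  refine lintegral_congr fun x => ?_
  rw [crossingMass, freeMove_neg_exitTime hmn, flow_flow hM, add_neg_cancel, flow_zero hM,
    freeMove_exitTime hmn]

/-- Integration over the starting points with a crossing is integration over the exit times. -/
theorem lintegral_exitTime (N : ℕ) (pn : ℝ) {T : ℝ} (hT1 : T < 1) (J : ℝ → ℝ≥0∞) :
    (∫⁻ n in Ico (N : ℝ) (N + 1), if exitTime N n pn ≤ T then J (exitTime N n pn) else 0) =
      ∫⁻ h in Icc 0 T, J h := by
  rw [← lintegral_indicator measurableSet_Ico, ← lintegral_indicator measurableSet_Icc]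
  by_cases hpn : 0 ≤ pn
  · rw [← lintegral_sub_left_eq_self _ ((N : ℝ) + 1)]
    refine lintegral_congr_ae ?_
    -- The half-open interval `[N, N + 1)` excludes `h = 0` for a motion to the right. At the other
    -- end `h ≤ T < 1` makes the bound by the length of the interval automatic.
    filter_upwards [Measure.ae_ne volume (0 : ℝ)] with h hh
    simp only [indicator, mem_Ico, mem_Icc, exitTime, if_pos hpn, sub_sub_cancel]
    by_cases h0 : 0 ≤ h
    · have h0' : 0 < h := lt_of_le_of_ne h0 (Ne.symm hh)
      by_cases hT : h ≤ T
      · rw [if_pos ⟨by linarith, by linarith⟩, if_pos hT, if_pos ⟨h0, hT⟩]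
      · rw [if_neg hT, ite_self, if_neg fun h' : 0 ≤ h ∧ h ≤ T => hT h'.2]
    · rw [if_neg fun h' => by linarith [h'.2], if_neg fun h' => h0 h'.1]
  · rw [← lintegral_add_right_eq_self _ (N : ℝ)]
    refine lintegral_congr fun h => ?_
    simp only [indicator, mem_Ico, mem_Icc, exitTime, if_neg hpn, add_sub_cancel_right]
    by_cases h0 : 0 ≤ h
    · by_cases hT : h ≤ T
      · rw [if_pos ⟨by linarith, by linarith⟩, if_pos hT, if_pos ⟨h0, hT⟩]
      · rw [if_neg hT, ite_self, if_neg fun h' : 0 ≤ h ∧ h ≤ T => hT h'.2]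
    · rw [if_neg fun h' => h0 (by linarith [h'.1]), if_neg fun h' => h0 h'.1]

theorem measurable_freeMass (hM : M.Complete) (hf : Measurable f)
    (hg : Measurable g) (T : ℝ) (N : ℕ) :
    Measurable fun z : ℝ × ℝ => M.freeMass f g T N z.1 z.2 := by
  have h : Measurable fun z : (ℝ × ℝ) × M.QP N => (⟨N, (z.2, (z.1.2, z.1.1))⟩ : M.State) :=
    measurable_state N measurable_snd measurable_fst.snd measurable_fst.fst
  exact Measurable.lintegral_prod_right' (f := fun z : (ℝ × ℝ) × M.QP N =>
    f ⟨N, (z.2, (z.1.2, z.1.1))⟩ * g (M.freeMove T ⟨N, (z.2, (z.1.2, z.1.1))⟩))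
    ((hf.comp h).mul (hg.comp ((measurable_freeMove_const hM T).comp h)))

theorem measurable_exitTime (N : ℕ) : Measurable fun z : ℝ × ℝ => exitTime N z.2 z.1 :=
  Measurable.ite (measurableSet_le measurable_const measurable_fst) (by fun_prop) (by fun_prop)

/-- Decomposition of the transitions into those without and those with a crossing. -/
theorem Regular.lintegral_transition (hR : M.Regular) (hM : M.Complete) (hmn : M.mn = 1)
    (hf : Measurable f) (hg : Measurable g) {T : ℝ} (hT1 : T < 1) :
    ∫⁻ s, f s * ∫⁻ s', g s' ∂M.kernel T s ∂M.target = ENNReal.ofReal (M.Zβ⁻¹ * M.Zn⁻¹) *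
      (∑' N : ℕ, ∫⁻ pn, M.freeMassAt f g T N pn ∂M.momLaw +
        ∫⁻ h in Icc 0 T, ∫⁻ s, M.crossingMass f g T h s ∂M.crossingLaw) := by
  have hκ : Measurable fun s => ∫⁻ s', g s' ∂M.kernel T s :=
    (Measure.measurable_lintegral hg).comp (hR.measurable_kernel hM hmn hT1)
  have hcm := hR.measurable_crossingMass hM hf hg T
  rw [hR.lintegral_target (hf.fun_mul hκ)]
  congr 1
  rw [lintegral_lintegral_swap (ν := M.crossingLaw) (f := fun h s => M.crossingMass f g T h s)
    hcm.aemeasurable, lintegral_crossingLaw hcm.lintegral_prod_left', ← ENNReal.tsum_add]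
  refine tsum_congr fun N => ?_
  have hfree : Measurable fun z : ℝ × ℝ =>
      if exitTime N z.2 z.1 ≤ T then 0 else M.freeMass f g T N z.1 z.2 :=
    Measurable.ite (measurableSet_le (measurable_exitTime N) measurable_const) measurable_const
      (measurable_freeMass hM hf hg T N)
  have hfreeAt : Measurable fun pn => M.freeMassAt f g T N pn := hfree.lintegral_prod_right'
  rw [← lintegral_add_left hfreeAt]
  refine lintegral_congr fun pn => ?_
  have hcm' : Measurable fun z : ℝ × M.QP N =>
      M.crossingMass f g T z.1 (M.crossingState N pn z.2) := by
    have h : Measurable fun z : ℝ × M.QP N => (z.1, M.crossingState N pn z.2) :=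
      measurable_fst.prodMk ((measurable_crossingState N).comp
        (measurable_const.prodMk measurable_snd))
    exact hcm.comp h
  rw [← lintegral_lintegral_swap (f := fun h x => M.crossingMass f g T h (M.crossingState N pn x))
    hcm'.aemeasurable, ← lintegral_exitTime N pn hT1, freeMassAt, ← lintegral_add_left]
  · refine lintegral_congr fun n => ?_
    simp only [lintegral_kernel hM hmn hT1 _ hg, hitTime_mk hmn]
    split_ifs
    · rw [zero_add, hR.lintegral_crossing_start hM hmn hf hg]
    · rw [add_zero, freeMass]
  · exact hfree.comp measurable_prodMk_left

/-- Almost no crossing stops the indicator. -/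
theorem Regular.ae_jump_ne_zero (hR : M.Regular) (hE : M.InsEven) (hmn : M.mn = 1) :
    ∀ᵐ s ∂M.crossingLaw, s.2.2.2 ≠ 0 ∧ ∀ᵐ s' ∂M.jump s, s'.2.2.2 ≠ 0 := by
  set S : Set M.State := {s | s.2.2.2 = 0} with hS
  have hpn : Measurable fun s : M.State => s.2.2.2 := by
    refine measurable_of_sigma fun N => ?_
    exact (measurable_snd.comp measurable_snd : Measurable fun z : M.QP N × (ℝ × ℝ) => z.2.2)
  have hSm : MeasurableSet S := hpn (measurableSet_singleton 0)
  have hI : Measurable (S.indicator (1 : M.State → ℝ≥0∞)) := measurable_one.indicator hSm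
  have h0 : M.crossingLaw S = 0 := by
    rw [← lintegral_indicator_one hSm, lintegral_crossingLaw hI, ENNReal.tsum_eq_zero]
    intro N
    rw [← lintegral_zero (μ := M.momLaw)]
    refine lintegral_congr_ae ?_
    filter_upwards [ae_momLaw_ne_zero] with pn hpn
    have h : ∀ x, M.crossingState N pn x ∉ S := fun x => hpn
    simp [h]
  have h1 : ∀ᵐ s ∂M.crossingLaw, s.2.2.2 ≠ 0 := by
    rw [ae_iff]
    simpa only [not_not] using h0
  refine h1.and ?_
  -- By skew balance, crossings that end with `p_n = 0` have the same mass as those that start with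
  -- `p_n = 0`, which is zero.
  have hb := hR.crossing_skew_balance hE hmn (Ψ := fun _ s' => S.indicator 1 s')
    (hI.comp measurable_snd)
  have hflip (s : M.State) : S.indicator (1 : M.State → ℝ≥0∞) (M.flip s) = S.indicator 1 s := by
    simp [indicator, S, flip]
  have hz : ∫⁻ s, ∫⁻ _, S.indicator (1 : M.State → ℝ≥0∞) (M.flip s) ∂M.jump s ∂M.crossingLaw
      = 0 := by
    rw [← lintegral_zero (μ := M.crossingLaw)]
    refine lintegral_congr_ae ?_
    filter_upwards [h1] with s hs
    have h : s ∉ S := hs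
    simp [hflip, h]
  rw [hz, lintegral_eq_zero_iff (hR.measurable_lintegral_jump hI)] at hb
  filter_upwards [hb] with s hs
  rw [lintegral_indicator_one hSm] at hs
  rw [ae_iff]
  simp only [not_not]
  exact hs

/-- Crossing balance is applied to the product of `f` moved back by `h` and `g` moved on by `T - h`.
Pulling the reversals through the free motion interchanges the two durations, which is legitimate
because `p_n` is almost surely nonzero on both sides. -/
theorem Regular.lintegral_crossingMass (hR : M.Regular) (hM : M.Complete) (hE : M.InsEven)
    (hmn : M.mn = 1) (hf : Measurable f) (hg : Measurable g) (T h : ℝ) :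
    ∫⁻ s, M.crossingMass f g T h s ∂M.crossingLaw =
      ∫⁻ s, M.crossingMass (g ∘ M.flip) (f ∘ M.flip) T (T - h) s ∂M.crossingLaw := by
  have hf' := hf.comp (measurable_freeMove_const hM (-h))
  have hg' := hg.comp (measurable_freeMove_const hM (T - h))
  have h1 := hR.crossing_skew_balance hE hmn
    (Ψ := fun s s' => f (M.freeMove (-h) s) * g (M.freeMove (T - h) s'))
    ((hf'.comp measurable_fst).mul (hg'.comp measurable_snd))
  have h2 (s : M.State) : ∫⁻ s', f (M.freeMove (-h) s) * g (M.freeMove (T - h) s') ∂M.jump s =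
      M.crossingMass f g T h s := lintegral_const_mul _ hg'
  simp only [h2] at h1
  rw [h1]
  refine lintegral_congr_ae ?_
  filter_upwards [hR.ae_jump_ne_zero hE hmn] with s hs
  have hf'' : Measurable fun s' => (f ∘ M.flip) (M.freeMove (T - (T - h)) s') :=
    (hf.comp measurable_flip).comp (measurable_freeMove_const hM _)
  rw [crossingMass, ← lintegral_const_mul _ hf'']
  refine lintegral_congr_ae ?_
  filter_upwards [hs.2] with s' hs'
  rw [freeMove_flip hM hmn _ hs', freeMove_flip hM hmn _ hs.1, mul_comm]
  simp only [Function.comp_apply, sub_sub_cancel, neg_neg]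

/-- Skew detailed balance, in integrated form. -/
theorem Regular.lintegral_skew_balance (hR : M.Regular) (hM : M.Complete) (hE : M.InsEven)
    (hmn : M.mn = 1) (hf : Measurable f) (hg : Measurable g) {T : ℝ} (hT0 : 0 ≤ T) (hT1 : T < 1) :
    ∫⁻ s, f s * ∫⁻ s', g s' ∂M.kernel T s ∂M.target =
      ∫⁻ s, (g ∘ M.flip) s * ∫⁻ s', (f ∘ M.flip) s' ∂M.kernel T s ∂M.target := by
  rw [hR.lintegral_transition hM hmn hf hg hT1, hR.lintegral_transition hM hmn
    (hg.comp measurable_flip) (hf.comp measurable_flip) hT1]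
  simp only [hR.lintegral_freeMassAt hM hmn hf hg hT0, hR.lintegral_crossingMass hM hE hmn hf hg]
  congr 2
  -- A crossing at time `h` occurs at time `T - h` in the reversed transition, and this reflection
  -- preserves Lebesgue measure on `[0, T]`.
  rw [← lintegral_indicator measurableSet_Icc, ← lintegral_indicator measurableSet_Icc,
    ← lintegral_sub_left_eq_self _ T]
  refine lintegral_congr fun h => ?_
  have hiff : T - h ∈ Icc 0 T ↔ h ∈ Icc 0 T := by
    simp only [mem_Icc]
    constructor <;> rintro ⟨h1, h2⟩ <;> exact ⟨by linarith, by linarith⟩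
  by_cases hh : h ∈ Icc 0 T
  · rw [indicator_of_mem hh, indicator_of_mem (hiff.2 hh), sub_sub_cancel]
  · rw [indicator_of_notMem hh, indicator_of_notMem (mt hiff.1 hh)]

theorem Regular.skew_balance (hR : M.Regular) (hM : M.Complete) (hE : M.InsEven)
    (hmn : M.mn = 1) {T : ℝ} (hT0 : 0 ≤ T) (hT1 : T < 1) {A B : Set M.State}
    (hA : MeasurableSet A) (hB : MeasurableSet B) :
    ∫⁻ s in A, M.kernel T s B ∂M.target =
      ∫⁻ s in M.flip ⁻¹' B, M.kernel T s (M.flip ⁻¹' A) ∂M.target := by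
  have key (A B : Set M.State) (hA : MeasurableSet A) (hB : MeasurableSet B) :
      ∫⁻ s in A, M.kernel T s B ∂M.target =
        ∫⁻ s, A.indicator 1 s * ∫⁻ s', B.indicator 1 s' ∂M.kernel T s ∂M.target := by
    rw [← lintegral_indicator hA]
    refine lintegral_congr fun s => ?_
    rw [lintegral_indicator_one hB]
    by_cases hs : s ∈ A
    · simp [hs]
    · simp [hs]
  rw [key A B hA hB, key _ _ (measurable_flip hB) (measurable_flip hA)]
  exact hR.lintegral_skew_balance hM hE hmn (measurable_one.indicator hA)
    (measurable_one.indicator hB) hT0 hT1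

end Model

/-! ### Transfer from regularized models to arbitrary ones -/

namespace Model

variable {M : Model}

open Classical in
variable (M) in
/-- The model with potentials and insertion densities set to zero off the domains. -/
abbrev regularize : Model where
  __ := M
  U N := (M.V N).indicator (M.U N)
  contDiffOn_U N := (M.contDiffOn_U N).congr fun _ hq => indicator_of_mem hq _
  Z_pos := by
    refine M.Z_pos.trans_eq (tsum_congr fun N => ?_)
    refine setLIntegral_congr_fun (M.isOpen_V N).measurableSet fun q hq => ?_
    simp only [indicator_of_mem hq]
  Z_lt_top := by
    refine lt_of_eq_of_lt (tsum_congr fun N => ?_) M.Z_lt_top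
    refine setLIntegral_congr_fun (M.isOpen_V N).measurableSet fun q hq => ?_
    simp only [indicator_of_mem hq]
  ins N w x := if x.1 ∈ M.V N then M.ins N w x else 0
  ins_nonneg N w x := by
    split_ifs
    exacts [M.ins_nonneg N w x, le_rfl]
  measurable_ins N := Measurable.ite
    ((M.isOpen_V N).measurableSet.preimage (measurable_snd.fst)) (M.measurable_ins N)
    measurable_const
  lintegral_ins N x hx := by
    simp only [if_pos hx]
    exact M.lintegral_ins N x hx
  ins_support N w x hx hw := by
    rw [if_pos hx]
    exact M.ins_support N w x hx hw

theorem regularize_U {N : ℕ} {q : RVec (M.d N)} (hq : q ∈ M.V N) :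
    M.regularize.U N q = M.U N q := indicator_of_mem hq _

theorem regularize_ins {N : ℕ} {x : M.QP N} (hx : x.1 ∈ M.V N) (w : M.New N) :
    M.regularize.ins N w x = M.ins N w x := if_pos hx

theorem regularize_ham {N : ℕ} {x : M.QP N} (hx : x.1 ∈ M.V N) :
    M.regularize.ham N x = M.ham N x :=
  congrArg (fun u => u + M.kin x.2 + M.d N / (2 * M.β) * Real.log (2 * M.m * Real.pi / M.β))
    (regularize_U hx)

theorem regular_regularize : M.regularize.Regular where
  measurable_U N := by
    classical
    change Measurable ((M.V N).indicator (M.U N))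
    rw [← piecewise_eq_indicator]
    exact (M.contDiffOn_U N).continuousOn.measurable_piecewise continuousOn_const
      (M.isOpen_V N).measurableSet
  ins_eq_zero N w x hx := if_neg hx

/-- Trajectories stay in the open domain, near each point of which the two potentials coincide;
hence so do their gradients. -/
theorem isTrajectory_regularize (N : ℕ) (γ : ℝ → M.QP N) :
    M.regularize.IsTrajectory N γ ↔ M.IsTrajectory N γ := by
  refine forall_congr' fun t => and_congr_right fun ht => ?_
  have h : gradient (M.regularize.U N) (γ t).1 = gradient (M.U N) (γ t).1 := by
    have : M.regularize.U N =ᶠ[𝓝 (γ t).1] M.U N := by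
      filter_upwards [(M.isOpen_V N).mem_nhds ht] with q hq using regularize_U hq
    exact congrArg (InnerProductSpace.toDual ℝ (RVec (M.d N))).symm this.fderiv_eq
  rw [h]

theorem complete_regularize (hM : M.Complete) : M.regularize.Complete := by
  intro N x hx
  obtain ⟨γ, hγ, h0⟩ := hM N x hx
  exact ⟨γ, (isTrajectory_regularize N γ).2 hγ, h0⟩

theorem flow_regularize (hM : M.Complete) (N : ℕ) (t : ℝ) (x : M.QP N) :
    M.regularize.flow N t x = M.flow N t x := by
  by_cases hx : x.1 ∈ M.V N
  · have h1 := isTrajectory_flow hM hx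
    have h2 : M.flow N t x = M.regularize.flow N t (M.flow N 0 x) :=
      ((isTrajectory_regularize N _).2 h1.1).eq_flow (complete_regularize hM) t
    exact (h2.trans (congrArg (M.regularize.flow N t) h1.2)).symm
  · rw [M.flow_of_notMem hx]
    exact M.regularize.flow_of_notMem hx t

theorem freeMove_regularize (hM : M.Complete) (t : ℝ) (s : M.State) :
    M.regularize.freeMove t s = M.freeMove t s := by
  have h := flow_regularize hM s.1 t s.2.1
  change (⟨s.1, (M.regularize.flow s.1 t s.2.1, _)⟩ : M.State) = _
  rw [h]
  rfl

theorem truncate_mem {N : ℕ} {x : M.QP (N + 1)} (hx : x.1 ∈ M.V (N + 1)) :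
    (M.truncate N x).1 ∈ M.V N := by
  rw [← M.head_image_V N]
  exact ⟨x.1, hx, rfl⟩

theorem barrierUp_regularize {N : ℕ} {x : M.QP N} (hx : x.1 ∈ M.V N) {w : M.New N}
    (hw : (M.extend N x w).1 ∈ M.V (N + 1)) :
    M.regularize.barrierUp N x w = M.barrierUp N x w := by
  have h1 : M.regularize.ham (N + 1) (M.regularize.extend N x w) = M.ham (N + 1) (M.extend N x w) :=
    regularize_ham hw
  exact congrArg₂ (· + ·) (congrArg₂ (· - ·) h1 (regularize_ham hx))
    (congrArg (fun r => 1 / M.β * Real.log r) (regularize_ins hx w))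

theorem barrierDown_regularize {N : ℕ} {x : M.QP (N + 1)} (hx : x.1 ∈ M.V (N + 1)) :
    M.regularize.barrierDown N x = M.barrierDown N x := by
  have h1 : M.regularize.ham N (M.regularize.truncate N x) = M.ham N (M.truncate N x) :=
    regularize_ham (truncate_mem hx)
  have h2 : M.regularize.ins N (M.regularize.removed N x) (M.regularize.truncate N x) =
      M.ins N (M.removed N x) (M.truncate N x) := regularize_ins (truncate_mem hx) _
  exact congrArg₂ (· - ·) (congrArg₂ (· - ·) h1 (regularize_ham hx))
    (congrArg (fun r => 1 / M.β * Real.log r) h2)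

theorem afterInsertion_regularize {N : ℕ} {x : M.QP N} (hx : x.1 ∈ M.V N) (n pn : ℝ) {w : M.New N}
    (hw : (M.extend N x w).1 ∈ M.V (N + 1)) :
    M.regularize.afterInsertion N x n pn w = M.afterInsertion N x n pn w := by
  simp only [afterInsertion, barrierUp_regularize hx hw]
  rfl

theorem afterDeletion_regularize {N : ℕ} {x : M.QP N} (hx : x.1 ∈ M.V N) (n pn : ℝ) :
    M.regularize.afterDeletion N x n pn = M.afterDeletion N x n pn := by
  cases N with
  | zero => rfl
  | succ N =>
    have h2 : M.regularize.ins N (M.regularize.removed N x) (M.regularize.truncate N x) =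
        M.ins N (M.removed N x) (M.truncate N x) := regularize_ins (truncate_mem hx) _
    exact congrArg₂ (fun i b : ℝ => if 0 < i ∧ b ≤ M.kinN pn then
      (⟨N, (M.truncate N x, (n, pn - sgn pn * (M.mn * b)))⟩ : M.State)
      else ⟨N + 1, (x, (n, -pn))⟩) h2 (barrierDown_regularize hx)

theorem jump_regularize {s : M.State} (hs : s.2.1.1 ∈ M.V s.1) :
    M.regularize.jump s = M.jump s := by
  obtain ⟨N, x, n, pn⟩ := s
  by_cases hpn : 0 ≤ pn
  · refine (jump_of_nonneg (M := M.regularize) N x n hpn).trans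
      (Eq.trans ?_ (jump_of_nonneg (M := M) N x n hpn).symm)
    have h1 : (fun w : M.New N => ENNReal.ofReal (M.regularize.ins N w x)) =
        fun w => ENNReal.ofReal (M.ins N w x) :=
      funext fun w => congrArg ENNReal.ofReal (regularize_ins hs w)
    -- The barriers may differ if the extended point leaves `V_{N+1}`, but there the insertion
    -- density vanishes.
    have h2 : M.regularize.afterInsertion N x n pn
        =ᵐ[volume.withDensity fun w => ENNReal.ofReal (M.ins N w x)]
          M.afterInsertion N x n pn := by
      rw [Filter.EventuallyEq, ae_withDensity_iff (measurable_ofReal_ins N x)]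
      refine ae_of_all _ fun w hw => ?_
      refine afterInsertion_regularize hs n pn ?_
      by_contra hext
      exact hw (by rw [M.ins_support N w x hs hext, ENNReal.ofReal_zero])
    exact (congrArg (fun ρ : M.New N → ℝ≥0∞ => Measure.map (M.regularize.afterInsertion N x n pn)
      (volume.withDensity ρ)) h1).trans (Measure.map_congr h2)
  · refine (jump_of_neg (M := M.regularize) N x n hpn).trans
      (Eq.trans ?_ (jump_of_neg (M := M) N x n hpn).symm)
    exact congrArg Measure.dirac (afterDeletion_regularize hs n pn)

theorem kernel_regularize (hM : M.Complete) (hmn : M.mn = 1) {T : ℝ} (hT1 : T < 1) {s : M.State}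
    (hs : s.2.1.1 ∈ M.V s.1) : M.regularize.kernel T s = M.kernel T s := by
  have h1 : M.regularize.hitTime s = M.hitTime s := rfl
  have h2 : M.regularize.jump (M.freeMove (M.hitTime s) s) =
      M.jump (M.freeMove (M.hitTime s) s) := jump_regularize (flow_mem hM hs _)
  have h3 : ∀ t, M.regularize.freeMove t = M.freeMove t := fun t =>
    funext fun s => freeMove_regularize hM t s
  refine (kernel_eq (M := M.regularize) hmn hT1 s).trans
    (Eq.trans ?_ (kernel_eq (M := M) hmn hT1 s).symm)
  simp only [h1, h3]
  rw [h2]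

theorem target_regularize : M.regularize.target = M.target := by
  refine congrArg Measure.sum (funext fun N => ?_)
  refine congrArg (Measure.map fun z : M.QP N × (ℝ × ℝ) => (⟨N, z⟩ : M.State)) ?_
  refine withDensity_congr_ae ?_
  have hS : MeasurableSet {z : M.QP N × (ℝ × ℝ) | z.1.1 ∈ M.V N ∧ z.2.1 ∈ Ico (N : ℝ) (N + 1)} :=
    ((measurableSet_domain N).preimage measurable_fst).inter
      (measurableSet_Ico.preimage measurable_snd.fst)
  have hZ : M.regularize.Zβ = M.Zβ := by
    refine congrArg ENNReal.toReal (tsum_congr fun N => ?_)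
    refine setLIntegral_congr_fun (M.isOpen_V N).measurableSet fun q hq => ?_
    exact congrArg (fun u => ENNReal.ofReal (Real.exp (-M.β * u))) (regularize_U hq)
  refine (ae_restrict_iff' hS).2 (ae_of_all _ fun z hz => ?_)
  exact congrArg₂ (fun Z u => ENNReal.ofReal ((Z⁻¹ * Real.exp (-M.β * u)) *
    ((M.Zp N)⁻¹ * Real.exp (-M.β * M.kin z.1.2)) * (M.Zn⁻¹ * Real.exp (-M.β * M.kinN z.2.2))))
    hZ (regularize_U hz.1)

theorem ae_target_mem : ∀ᵐ s ∂M.target, s.2.1.1 ∈ M.V s.1 := by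
  have hV : MeasurableSet {s : M.State | s.2.1.1 ∈ M.V s.1} :=
    MeasurableSpace.measurableSet_iInf.2 fun N => measurable_fst (measurableSet_domain N)
  rw [target, Measure.ae_sum_iff' hV]
  intro N
  rw [ae_map_iff (measurable_sigmaMk (β := fun N => M.QP N × (ℝ × ℝ)) N).aemeasurable hV]
  refine (withDensity_absolutelyContinuous _ _).ae_le ?_
  have hS : MeasurableSet {z : M.QP N × (ℝ × ℝ) | z.1.1 ∈ M.V N ∧ z.2.1 ∈ Ico (N : ℝ) (N + 1)} :=
    ((measurableSet_domain N).preimage measurable_fst).inter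
      (measurableSet_Ico.preimage measurable_snd.fst)
  exact (ae_restrict_iff' hS).2 (ae_of_all _ fun z hz => hz.1)

end Model

end DHMC

end

/-! ### Conclusion for the given model -/

theorem lemma1 (M : DHMC.Model) (hmn : M.mn = 1) (hM : M.Complete)
    (heven : ∀ N, ∀ q ∈ M.V N, ∀ p qnew pnew,
      M.ins N (qnew, -pnew) (q, -p) = M.ins N (qnew, pnew) (q, p))
    (T : ℝ) (hT0 : 0 ≤ T) (hT1 : T < 1) :
    (∀ s ∈ M.phaseSpace, MeasureTheory.IsProbabilityMeasure (M.kernel T s)) ∧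
    Measurable (fun s : M.phaseSpace => M.kernel T s) ∧
    ∀ A B : Set M.State, MeasurableSet A → MeasurableSet B →
      ∫⁻ s in A, M.kernel T s B ∂M.target =
        ∫⁻ s in M.flip ⁻¹' B, M.kernel T s (M.flip ⁻¹' A) ∂M.target := by
  have hR := DHMC.Model.regular_regularize (M := M)
  have hM' := DHMC.Model.complete_regularize hM
  -- Evenness is assumed only for `q` in the domain; off it the regularized densities are zero,
  -- hence even as well.
  have hE : M.regularize.InsEven := by
    intro N w x
    by_cases hx : x.1 ∈ M.V N
    · have h : M.regularize.ins N (DHMC.reverse w) (DHMC.reverse x) =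
          M.ins N (w.1, -w.2) (x.1, -x.2) :=
        DHMC.Model.regularize_ins (M := M) (x := DHMC.reverse x) hx (DHMC.reverse w)
      exact h.trans ((heven N x.1 hx x.2 w.1 w.2).trans (DHMC.Model.regularize_ins (M := M) hx w).symm)
    · exact (hR.ins_eq_zero N _ (DHMC.reverse x) hx).trans (hR.ins_eq_zero N w x hx).symm
  have hk : ∀ s : M.State, s.2.1.1 ∈ M.V s.1 → M.regularize.kernel T s = M.kernel T s :=
    fun s hs => DHMC.Model.kernel_regularize hM hmn hT1 hs
  refine ⟨fun s hs => ?_, ?_, fun A B hA hB => ?_⟩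
  · rw [← hk s hs.1]
    exact hR.isProbabilityMeasure_kernel hM' hmn hT1 (s := s) hs
  · have h := (hR.measurable_kernel hM' hmn hT1).comp
      (measurable_subtype_coe : Measurable fun s : M.phaseSpace => (s : M.State))
    have he : (fun s : M.phaseSpace => M.kernel T s) = fun s : M.phaseSpace =>
        M.regularize.kernel T s := funext fun s => (hk s s.2.1).symm
    rw [he]
    exact h
  · have h := hR.skew_balance hM' hE hmn hT0 hT1 hA hB
    -- The two kernels are known to agree only for positions in the domains, which carry the target.
    have hc (C D : Set M.State) : ∫⁻ s in C, M.regularize.kernel T s D ∂M.target =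
        ∫⁻ s in C, M.kernel T s D ∂M.target := by
      refine MeasureTheory.lintegral_congr_ae (MeasureTheory.ae_restrict_of_ae ?_)
      filter_upwards [M.ae_target_mem] with s hs
      exact congrArg (fun μ : MeasureTheory.Measure M.State => μ D) (hk s hs)
    rw [DHMC.Model.target_regularize] at h
    exact (hc _ _).symm.trans (h.trans (hc _ _))
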